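/- Let $(W,S)$ be a Coxeter system with $S$ finite (for example the Weyl group of a Kac--Moody group with its simple reflections), let $\ell$ be its length function and let $\leq$ denote the Bruhat order on $W$. For $w,v\in W$ let $w\circ_l v$ denote the unique minimal element, with respect to $\leq$, of the set $\{w'v : w'\in W,\ w'\leq w\}$ (this minimal element is its minimum). Let $$Q=\{(w,v,u)\in W^3 : w\circ_l v\leq u\},$$ partially ordered by $(w',v',u')\leq(w,v,u)$ if and only if $w'\leq w$, $v\leq v'$ and $u'\leq u$, and let $\hat Q=Q\sqcup\{\hat 0\}$ be the poset obtained from $Q$ by adjoining a minimum $\hat 0$. Then for every $q\in\hat Q$ the interval $[\hat 0,q]=\{p\in\hat Q : p\leq q\}$ is shellable. That is: this interval is a finite poset; it is pure, meaning that for all $x\leq y$ in it there is a maximal chain $x=z_0\lessdot z_1\lessdot\cdots\lessdot z_n=y$ and all such chains have the same length; and the maximal faces of its order complex (the simplicial complex whose faces are the finite chains) can be enumerated as $F_1,\dots,F_n$ such that for $k=2,\dots,n$ the intersection $F_k\cap\bigcup_{i<k}F_i$ is a nonempty union of maximal proper faces of $F_k$. -/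

import Mathlib

/-! ### Posets: purity, order complexes, shellability -/

/-- `x ⋖ ⋯ ⋖ y`: finite saturated chains from `x` to `y`. -/
def IsMaximalChainBetween {P : Type*} [PartialOrder P] (x y : P)
    (c : RelSeries {p : P × P | p.1 ⋖ p.2}) : Prop :=
  c.head = x ∧ c.last = y

/-- A poset is pure if for all `x ≤ y` there is a finite maximal chain from `x` to `y`, and any two
of them have the same length. -/
def IsPurePoset (P : Type*) [PartialOrder P] : Prop :=
  ∀ x y : P, x ≤ y →
    (∃ c, IsMaximalChainBetween x y c) ∧
    ∀ c c', IsMaximalChainBetween x y c → IsMaximalChainBetween x y c' → c.length = c'.length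

/-- The order complex: vertices are the elements of `P`, faces are the (nonempty) finite chains. -/
def orderComplex (P : Type*) [PartialOrder P] : AbstractSimplicialComplex P where
  faces := {s | s.Nonempty ∧ IsChain (· ≤ ·) (s : Set P)}
  isRelLowerSet_faces := fun _ hs =>
    ⟨hs.1, fun _ hts ht => ⟨ht, hs.2.mono (by exact_mod_cast hts)⟩⟩
  singleton_mem v := ⟨Finset.singleton_nonempty v, by simp⟩

/-- `F 0, F 1, …, F (n-1)` is a shelling of `K`: an enumeration without repetition of the maximal
faces of `K` such that for every `k` other than the first index, `F k ∩ ⋃_{i < k} F i` (an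
intersection of subcomplexes, including the empty face) is the union of a nonempty family `𝒢` of
maximal proper faces of `F k`. -/
structure IsShelling {V : Type*} (K : AbstractSimplicialComplex V) {n : ℕ}
    (F : Fin n → Finset V) : Prop where
  injective : Function.Injective F
  range_eq : Set.range F = {s | Maximal (· ∈ K) s}
  inter_eq : ∀ k : Fin n, 0 < (k : ℕ) →
    ∃ 𝒢 : Set (Finset V), 𝒢.Nonempty ∧ (∀ G ∈ 𝒢, G ⋖ F k) ∧
      ∀ s : Finset V, (s ⊆ F k ∧ ∃ i < k, s ⊆ F i) ↔ ∃ G ∈ 𝒢, s ⊆ G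

/-- A poset is shellable if it is finite and pure and its order complex admits a shelling. -/
def IsShellablePoset (P : Type*) [PartialOrder P] : Prop :=
  Finite P ∧ IsPurePoset P ∧
    ∃ (n : ℕ) (F : Fin n → Finset P), IsShelling (orderComplex P) F

/-! ### The Bruhat order and the downward Demazure product -/

namespace CoxeterSystem

variable {B W : Type*} [Group W] {M : CoxeterMatrix B} (cs : CoxeterSystem M W)

/-- The Bruhat order `x ≤ y` on `W`: the reflexive transitive closure of the relations
`x < x t`, where `t` is a reflection and `ℓ x < ℓ (x t)`. -/
def BruhatLE (x y : W) : Prop :=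
  Relation.ReflTransGen
    (fun a b => ∃ t, cs.IsReflection t ∧ b = a * t ∧ cs.length a < cs.length b) x y

theorem BruhatLE.eq_or_length_lt {x y : W} (h : cs.BruhatLE x y) :
    x = y ∨ cs.length x < cs.length y := by
  induction h with
  | refl => exact Or.inl rfl
  | tail _ hbc ih =>
    obtain ⟨t, _, _, hlt⟩ := hbc
    rcases ih with rfl | ih
    · exact Or.inr hlt
    · exact Or.inr (ih.trans hlt)

theorem BruhatLE.antisymm {x y : W} (h : cs.BruhatLE x y) (h' : cs.BruhatLE y x) : x = y := by
  rcases BruhatLE.eq_or_length_lt cs h with e | h1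
  · exact e
  · rcases BruhatLE.eq_or_length_lt cs h' with e | h2
    · exact e.symm
    · omega

/-- `m` is the left downward Demazure product `w ∘ₗ v`, that is, the minimum of
`{w' v | w' ≤ w}` in the Bruhat order. -/
def IsLeftDownwardDemazure (w v m : W) : Prop :=
  (∃ w', cs.BruhatLE w' w ∧ m = w' * v) ∧ ∀ w', cs.BruhatLE w' w → cs.BruhatLE m (w' * v)

/-- The set `Q` of triples `(w, v, u)` with `w ∘ₗ v ≤ u`. -/
@[ext]
structure StratumIndex where
  w : W
  v : W
  u : W
  demazure_le : ∃ m, cs.IsLeftDownwardDemazure w v m ∧ cs.BruhatLE m u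

/-- `(w', v', u') ≤ (w, v, u)` iff `w' ≤ w`, `v ≤ v'` and `u' ≤ u` in the Bruhat order. -/
instance : PartialOrder (StratumIndex cs) where
  le p q := cs.BruhatLE p.w q.w ∧ cs.BruhatLE q.v p.v ∧ cs.BruhatLE p.u q.u
  le_refl _ := ⟨.refl, .refl, .refl⟩
  le_trans _ _ _ h h' := ⟨h.1.trans h'.1, h'.2.1.trans h.2.1, h.2.2.trans h'.2.2⟩
  le_antisymm _ _ h h' := StratumIndex.ext (BruhatLE.antisymm cs h.1 h'.1)
    (BruhatLE.antisymm cs h'.2.1 h.2.1) (BruhatLE.antisymm cs h.2.2 h'.2.2)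

end CoxeterSystem

/-!
The poset `Q` is a poset of intervals in a Bruhat order. Adjoin to `(W, S)` a new generator `z`
which satisfies no braid relation with the others. By the subword property the elements below
`w⁻¹ z u` in the larger Coxeter group are the elements `w'⁻¹ z u'` and `w'⁻¹ u'` with `w' ≤ w` and
`u' ≤ u`, and `w ∘ₗ v ≤ u` says exactly that `v = w'⁻¹ u'` for such `w'` and `u'`. Hence
`(w, v, u) ↦ (v, w⁻¹ z u)` identifies `Q` with the pairs `x ≤ y` in the larger Bruhat order such
that `x` lies in `W` and `y = w⁻¹ z u` for some `w`, `u`, ordered by inclusion of the intervals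
`[x, y]` (`CoxeterSystem.inclFree_le_crossFree_iff`, `CoxeterSystem.StratumIndex.crossingIso`). So a
principal ideal of `Q` is the poset of pairs `x ≤ y` in a Bruhat interval `P` which cross an upper
set `Y`, namely the set of the elements of `P` that involve `z`: `x ∉ Y` and `y ∈ Y`.

Shellability is proved for a graded poset by ranking its maximal chains by a key. The ranking is a
shelling if a maximal chain is determined, among the chains of at most the same key, by its entries
at those positions where exchanging a single entry decreases the key
(`IsChainShelling`, `isShellablePoset_of_isChainShelling`).

* For a Bruhat interval, fix a reduced word for the top. Each step down a maximal chain deletes one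
  letter of the word reached so far, and the chains are compared lexicographically by the positions
  of these letters, as in the theorem of Björner and Wachs
  (`CoxeterSystem.isChainShelling_chainKey`). This rests on the strong exchange property
  (`CoxeterSystem.exists_eraseIdx_of_length_mul_lt`).
* A maximal chain of crossing pairs of `P`, with a minimum adjoined, amounts to a maximal chain of
  `P` and a lattice path recording whether each step shrinks the interval from above or from below;
  the path ends at the step of the chain which leaves `Y`. The chains are ranked by the key of the
  chain of `P`, then by the area under the path. The sign of the area depends on the chain of `P`
  and is chosen such that every entry which can be exchanged there with a decrease of the key occurs
  in a crossing pair which can be exchanged as well (`isChainShelling_crossingKey`).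
-/

namespace CoxeterSystem

variable {B W : Type*} [Group W] {M : CoxeterMatrix B} (cs : CoxeterSystem M W)

/-! ### The strong exchange property -/

theorem _root_.Function.End.mul_apply {α : Type*} (f g : Function.End α) (x : α) :
    (f * g) x = f (g x) := rfl

theorem _root_.Function.End.one_apply {α : Type*} (x : α) : (1 : Function.End α) x = x := rfl

open Classical in
/-- The involution `(x, ε) ↦ (s x s, ε + [x = s])` of `W × ZMod 2` attached to a simple reflection
`s`. -/
noncomputable def signedConj (i : B) : Function.End (W × ZMod 2) := fun p =>
  (cs.simple i * p.1 * cs.simple i, p.2 + if p.1 = cs.simple i then 1 else 0)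

open Classical in
theorem signedConj_mul_pow (i j : B) (n : ℕ) (p : W × ZMod 2) :
    ((signedConj cs i * signedConj cs j) ^ n) p =
      ((cs.simple i * cs.simple j) ^ n * p.1 * ((cs.simple i * cs.simple j) ^ n)⁻¹,
        p.2 + ∑ r ∈ Finset.range (2 * n),
          if p.1 = cs.simple j * (cs.simple i * cs.simple j) ^ r then 1 else 0) := by
  set a := cs.simple i * cs.simple j with ha
  have hconj : ∀ l : ℕ, cs.simple j * a ^ l = (a ^ l)⁻¹ * cs.simple j := by
    intro l
    have : cs.simple j * a * (cs.simple j)⁻¹ = a⁻¹ := by simp [ha, mul_assoc]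
    rw [← inv_pow, ← this, conj_pow]; simp
  induction n with
  | zero => simp [Function.End.one_apply]
  | succ n ih =>
    rw [pow_succ', Function.End.mul_apply, ih]
    simp only [Function.End.mul_apply, signedConj]
    rw [show 2 * (n + 1) = 2 * n + 1 + 1 by ring, Finset.sum_range_succ, Finset.sum_range_succ]
    have h1 : a ^ n * p.1 * (a ^ n)⁻¹ = cs.simple j ↔ p.1 = cs.simple j * a ^ (2 * n) := by
      rw [two_mul, pow_add, ← mul_assoc, hconj, mul_inv_eq_iff_eq_mul, ← eq_inv_mul_iff_mul_eq,
        mul_assoc]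
    have h2 : cs.simple j * (a ^ n * p.1 * (a ^ n)⁻¹) * cs.simple j = cs.simple i ↔
        p.1 = cs.simple j * a ^ (2 * n + 1) := by
      have e : cs.simple j * (a ^ n * p.1 * (a ^ n)⁻¹) * cs.simple j = cs.simple i ↔
          a ^ n * p.1 * (a ^ n)⁻¹ = cs.simple j * a := by
        rw [← eq_mul_inv_iff_mul_eq, cs.inv_simple, ← ha, ← eq_inv_mul_iff_mul_eq, cs.inv_simple]
      rw [e, mul_inv_eq_iff_eq_mul, ← eq_inv_mul_iff_mul_eq, mul_assoc, ← mul_assoc _ (cs.simple j),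
        ← hconj, mul_assoc, ← pow_succ', ← pow_add]
      ring_nf
    refine Prod.ext ?_ ?_
    · simp only [pow_succ', mul_inv_rev, ha, cs.inv_simple, mul_assoc]
    · simp only [h1, h2, add_assoc]

theorem signedConj_isLiftable : M.IsLiftable (signedConj cs) := by
  classical
  intro i j
  funext p
  rw [signedConj_mul_pow]
  simp only [simple_mul_simple_pow, one_mul, inv_one, mul_one, two_mul, Finset.sum_range_add,
    pow_add]
  simp [← two_mul, CharTwo.two_eq_zero, Function.End.one_apply]

/-- The action of `W` on `W × ZMod 2` extending `signedConj`. -/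
noncomputable def signedAction : W →* Function.End (W × ZMod 2) :=
  cs.lift ⟨signedConj cs, signedConj_isLiftable cs⟩

open Classical in
theorem signedAction_wordProd (ω : List B) (p : W × ZMod 2) :
    signedAction cs (cs.wordProd ω) p =
      (cs.wordProd ω * p.1 * (cs.wordProd ω)⁻¹, p.2 + (cs.rightInvSeq ω).count p.1) := by
  induction ω with
  | nil => simp [Function.End.one_apply]
  | cons i ω ih =>
    rw [wordProd_cons, map_mul, Function.End.mul_apply, ih, signedAction,
      lift_apply_simple]
    have h : cs.wordProd ω * p.1 * (cs.wordProd ω)⁻¹ = cs.simple i ↔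
        (cs.wordProd ω)⁻¹ * cs.simple i * cs.wordProd ω = p.1 := by
      rw [mul_inv_eq_iff_eq_mul, mul_assoc, inv_mul_eq_iff_eq_mul, eq_comm]
    simp only [signedConj, rightInvSeq, List.count_cons, h, beq_iff_eq]
    refine Prod.ext ?_ ?_
    · simp [mul_assoc]
    · push_cast; simp [add_assoc]

theorem signedAction_apply (w : W) (p : W × ZMod 2) :
    signedAction cs w p = (w * p.1 * w⁻¹, p.2 + (signedAction cs w (p.1, 0)).2) := by
  obtain ⟨ω, rfl⟩ := cs.wordProd_surjective w
  simp [signedAction_wordProd]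

/-- The inversion sign of a reflection at itself is nontrivial. -/
theorem signedAction_reflection {t : W} (ht : cs.IsReflection t) :
    (signedAction cs t (t, 0)).2 = 1 := by
  obtain ⟨w, i, rfl⟩ := ht
  have h1 : (signedAction cs w⁻¹ * signedAction cs w) (cs.simple i, 0) = (cs.simple i, 0) := by
    rw [← map_mul]
    simp [Function.End.one_apply]
  rw [Function.End.mul_apply, signedAction_apply, signedAction_apply cs w] at h1
  simp only [Prod.mk.injEq] at h1
  rw [map_mul, map_mul, Function.End.mul_apply, Function.End.mul_apply, signedAction_apply cs w⁻¹]
  have h2 : w⁻¹ * (w * cs.simple i * w⁻¹) * w⁻¹⁻¹ = cs.simple i := by group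
  have h3 : ∀ ε, signedAction cs (cs.simple i) (cs.simple i, ε) = (cs.simple i, ε + 1) := by
    intro ε
    rw [signedAction, lift_apply_simple]
    simp [signedConj]
  simp only [h2, h3]
  rw [signedAction_apply]
  simp only [zero_add] at h1 ⊢
  linear_combination h1.2

/-- The strong exchange property. -/
theorem exists_eraseIdx_of_length_mul_lt {t : W} (ht : cs.IsReflection t) {ω : List B}
    (h : cs.length (cs.wordProd ω * t) < cs.length (cs.wordProd ω)) :
    ∃ j < ω.length, cs.wordProd ω * t = cs.wordProd (ω.eraseIdx j) := by
  classical
  have key : t ∈ cs.rightInvSeq ω := by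
    by_contra hmem
    obtain ⟨τ, hτ, hw⟩ := cs.exists_isReduced (cs.wordProd ω * t)
    have h1 : (signedAction cs (cs.wordProd ω * t) (t, 0)).2 = 1 := by
      rw [map_mul, Function.End.mul_apply, signedAction_apply cs t,
        signedAction_wordProd]
      simp [ht.mul_self, ht.inv, List.count_eq_zero.2 hmem, signedAction_reflection cs ht]
    rw [hw, signedAction_wordProd] at h1
    have hc : t ∈ cs.rightInvSeq τ := by
      by_contra hc
      simp [List.count_eq_zero.2 hc] at h1
    have := (cs.isRightInversion_of_mem_rightInvSeq hτ hc).2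
    rw [← hw, mul_assoc, ht.mul_self, mul_one] at this
    omega
  obtain ⟨j, hj, rfl⟩ := List.getElem_of_mem key
  rw [length_rightInvSeq] at hj
  refine ⟨j, hj, ?_⟩
  rw [← wordProd_mul_getD_rightInvSeq, List.getD_eq_getElem]

end CoxeterSystem

namespace CoxeterSystem

variable {B W : Type*} [Group W] {M : CoxeterMatrix B} (cs : CoxeterSystem M W)

/-! ### Subwords, lifting and gradedness of the Bruhat order -/

theorem BruhatLE.length_le {x y : W} (h : cs.BruhatLE x y) : cs.length x ≤ cs.length y := by
  rcases BruhatLE.eq_or_length_lt cs h with rfl | h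
  · exact le_rfl
  · exact h.le

theorem BruhatLE.eq_of_length_le {x y : W} (h : cs.BruhatLE x y)
    (hl : cs.length y ≤ cs.length x) : x = y := by
  rcases BruhatLE.eq_or_length_lt cs h with h | h
  · exact h
  · omega

theorem bruhatLE_mul_right {x t : W} (ht : cs.IsReflection t)
    (h : cs.length x < cs.length (x * t)) : cs.BruhatLE x (x * t) :=
  .single ⟨t, ht, rfl, h⟩

theorem bruhatLE_mul_left {x t : W} (ht : cs.IsReflection t)
    (h : cs.length x < cs.length (t * x)) : cs.BruhatLE x (t * x) := by
  have e : t * x = x * (x⁻¹ * t * x⁻¹⁻¹) := by group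
  rw [e] at h ⊢
  exact bruhatLE_mul_right cs (ht.conj x⁻¹) h

theorem BruhatLE.inv {x y : W} (h : cs.BruhatLE x y) : cs.BruhatLE x⁻¹ y⁻¹ := by
  induction h with
  | refl => exact .refl
  | @tail b c _ hbc ih =>
    obtain ⟨t, ht, rfl, hlt⟩ := hbc
    refine ih.trans ?_
    rw [mul_inv_rev, ht.inv]
    refine bruhatLE_mul_left cs ht ?_
    rwa [← ht.inv, ← mul_inv_rev, cs.length_inv, cs.length_inv]

theorem bruhatLE_inv_iff {x y : W} : cs.BruhatLE x⁻¹ y⁻¹ ↔ cs.BruhatLE x y :=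
  ⟨fun h => by simpa using BruhatLE.inv cs h, BruhatLE.inv cs⟩

/-- One half of the subword property: each step down in the Bruhat order deletes a letter, by the
strong exchange property. -/
theorem exists_sublist_of_bruhatLE {x : W} {ω : List B} (h : cs.BruhatLE x (cs.wordProd ω)) :
    ∃ τ, τ.Sublist ω ∧ x = cs.wordProd τ := by
  induction h using Relation.ReflTransGen.head_induction_on with
  | refl => exact ⟨ω, .refl _, rfl⟩
  | @head a c hac _ ih =>
    obtain ⟨τ, hτ, rfl⟩ := ih
    obtain ⟨t, ht, hc, hlt⟩ := hac
    have ha : a = cs.wordProd τ * t := by rw [hc, mul_assoc, ht.mul_self, mul_one]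
    rw [ha] at hlt
    obtain ⟨j, -, hj⟩ := exists_eraseIdx_of_length_mul_lt cs ht hlt
    exact ⟨τ.eraseIdx j, (List.eraseIdx_sublist _ _).trans hτ, ha.trans hj⟩

theorem simple_mul_step (i : B) {x t : W} (ht : cs.IsReflection t)
    (h : cs.length x < cs.length (x * t)) :
    cs.BruhatLE (cs.simple i * x) (cs.simple i * (x * t)) ∨ cs.simple i * x = x * t := by
  rcases lt_or_gt_of_ne (ht.length_mul_left_ne (cs.simple i * x)) with hlt | hgt
  · right
    obtain ⟨ω, hω, rfl⟩ := cs.exists_isReduced x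
    rw [← wordProd_cons] at hlt
    obtain ⟨j, hj, he⟩ := exists_eraseIdx_of_length_mul_lt cs ht hlt
    cases j with
    | zero =>
      rw [wordProd_cons, List.eraseIdx_cons_zero, mul_assoc] at he
      rw [← he, simple_mul_simple_cancel_left, he]
    | succ j =>
      rw [wordProd_cons, List.eraseIdx_cons_succ, wordProd_cons, mul_assoc, mul_right_inj] at he
      have h1 := cs.length_wordProd_le (ω.eraseIdx j)
      have h2 := List.length_eraseIdx_le ω j
      rw [he, hω.eq] at h
      omega
  · left
    rw [← mul_assoc]
    exact bruhatLE_mul_right cs ht hgt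

theorem simple_mul_bruhatLE_or (i : B) {x y : W} (h : cs.BruhatLE x y) :
    cs.BruhatLE (cs.simple i * x) y ∨ cs.BruhatLE (cs.simple i * x) (cs.simple i * y) := by
  induction h with
  | refl => exact Or.inr .refl
  | @tail b c _ hbc ih =>
    rcases ih with ih | ih
    · exact Or.inl (ih.tail hbc)
    · obtain ⟨t, ht, rfl, hlt⟩ := hbc
      rcases simple_mul_step cs i ht hlt with h | h
      · exact Or.inr (ih.trans h)
      · exact Or.inl (h ▸ ih)

theorem bruhatLE_simple_mul {i : B} {x : W} (h : cs.length x < cs.length (cs.simple i * x)) :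
    cs.BruhatLE x (cs.simple i * x) :=
  bruhatLE_mul_left cs (cs.isReflection_simple i) h

theorem simple_mul_bruhatLE {i : B} {x : W} (h : cs.length (cs.simple i * x) < cs.length x) :
    cs.BruhatLE (cs.simple i * x) x := by
  have := bruhatLE_simple_mul cs (i := i) (x := cs.simple i * x)
    (by rwa [simple_mul_simple_cancel_left])
  rwa [simple_mul_simple_cancel_left] at this

theorem BruhatLE.simple_mul_le {i : B} {x y : W} (h : cs.BruhatLE x y)
    (hy : cs.length (cs.simple i * y) < cs.length y) : cs.BruhatLE (cs.simple i * x) y := by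
  rcases simple_mul_bruhatLE_or cs i h with h | h
  · exact h
  · exact h.trans (simple_mul_bruhatLE cs hy)

theorem BruhatLE.simple_mul_mono {i : B} {x y : W} (h : cs.BruhatLE x y)
    (hy : cs.length y < cs.length (cs.simple i * y)) :
    cs.BruhatLE (cs.simple i * x) (cs.simple i * y) := by
  rcases simple_mul_bruhatLE_or cs i h with h | h
  · exact h.trans (bruhatLE_simple_mul cs hy)
  · exact h

theorem IsReduced.of_cons {i : B} {ω : List B} (h : cs.IsReduced (i :: ω)) : cs.IsReduced ω :=
  h.drop 1

theorem IsReduced.length_lt_simple_mul {i : B} {ω : List B} (h : cs.IsReduced (i :: ω)) :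
    cs.length (cs.wordProd ω) < cs.length (cs.simple i * cs.wordProd ω) := by
  rw [← wordProd_cons, h.eq, (IsReduced.of_cons cs h).eq]
  simp

/-- The other half of the subword property. -/
theorem bruhatLE_of_sublist {τ ω : List B} (hτ : τ.Sublist ω) (hω : cs.IsReduced ω) :
    cs.BruhatLE (cs.wordProd τ) (cs.wordProd ω) := by
  induction hτ with
  | slnil => exact .refl
  | cons i _ ih =>
    rw [wordProd_cons]
    exact (ih (IsReduced.of_cons cs hω)).trans
      (bruhatLE_simple_mul cs (IsReduced.length_lt_simple_mul cs hω))
  | cons_cons i _ ih =>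
    rw [wordProd_cons, wordProd_cons]
    exact BruhatLE.simple_mul_mono cs (ih (IsReduced.of_cons cs hω))
      (IsReduced.length_lt_simple_mul cs hω)

/-- If `s y < y` for a simple reflection `s`, then `y` has a reduced word starting with `s`. -/
theorem exists_isReduced_cons {i : B} {y : W}
    (hy : cs.length (cs.simple i * y) < cs.length y) :
    ∃ ω, cs.IsReduced (i :: ω) ∧ y = cs.wordProd (i :: ω) ∧ cs.simple i * y = cs.wordProd ω := by
  obtain ⟨ω, hω, he⟩ := cs.exists_isReduced (cs.simple i * y)
  have hy' : y = cs.wordProd (i :: ω) := by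
    rw [wordProd_cons, ← he, simple_mul_simple_cancel_left]
  refine ⟨ω, ?_, hy', he⟩
  have h1 := cs.length_wordProd_le (i :: ω)
  rw [IsReduced, ← hy']
  rw [← hy'] at h1
  rw [he, hω.eq] at hy
  simp only [List.length_cons] at *
  omega

theorem BruhatLE.le_or_simple_mul_le {i : B} {x y : W} (h : cs.BruhatLE x y)
    (hy : cs.length (cs.simple i * y) < cs.length y) :
    cs.BruhatLE x (cs.simple i * y) ∨ cs.BruhatLE (cs.simple i * x) (cs.simple i * y) := by
  obtain ⟨ω, hω, rfl, he⟩ := exists_isReduced_cons cs hy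
  obtain ⟨τ, hτ, rfl⟩ := exists_sublist_of_bruhatLE cs h
  rw [he]
  have hω' := IsReduced.of_cons cs hω
  cases hτ with
  | cons _ h' => exact Or.inl (bruhatLE_of_sublist cs h' hω')
  | cons_cons _ h' =>
    right
    rw [wordProd_cons, simple_mul_simple_cancel_left]
    exact bruhatLE_of_sublist cs h' hω'

/-- The lifting property. -/
theorem BruhatLE.le_simple_mul {i : B} {x y : W} (h : cs.BruhatLE x y)
    (hy : cs.length (cs.simple i * y) < cs.length y)
    (hx : cs.length x < cs.length (cs.simple i * x)) : cs.BruhatLE x (cs.simple i * y) := by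
  rcases BruhatLE.le_or_simple_mul_le cs h hy with h | h
  · exact h
  · exact (bruhatLE_simple_mul cs hx).trans h

theorem BruhatLE.simple_mul_le_simple_mul {i : B} {x y : W} (h : cs.BruhatLE x y)
    (hy : cs.length (cs.simple i * y) < cs.length y)
    (hx : cs.length (cs.simple i * x) < cs.length x) :
    cs.BruhatLE (cs.simple i * x) (cs.simple i * y) := by
  rcases BruhatLE.le_or_simple_mul_le cs h hy with h | h
  · exact (simple_mul_bruhatLE cs hx).trans h
  · exact h

theorem exists_simple_mul_lt_of_bruhatLE_ne {x y : W} (h : cs.BruhatLE x y) (hne : x ≠ y) :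
    ∃ i, cs.length (cs.simple i * y) < cs.length y := by
  refine cs.exists_leftDescent_of_ne_one ?_
  rintro rfl
  refine hne (BruhatLE.eq_of_length_le cs h ?_)
  simp

/-- The Bruhat order is graded by the length. -/
theorem exists_bruhat_coatom {x y : W} (h : cs.BruhatLE x y) (hne : x ≠ y) :
    ∃ z, cs.BruhatLE x z ∧ cs.BruhatLE z y ∧ cs.length z + 1 = cs.length y := by
  induction hn : cs.length y generalizing x y with
  | zero => exact absurd (BruhatLE.eq_of_length_le cs h (by omega)) hne
  | succ n ih =>
    obtain ⟨i, hi⟩ := exists_simple_mul_lt_of_bruhatLE_ne cs h hne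
    have hly : cs.length (cs.simple i * y) = n := by
      rcases cs.length_simple_mul y i with h | h <;> omega
    rcases lt_or_gt_of_ne (cs.length_simple_mul_ne x i) with hx | hx
    · have h1 := BruhatLE.simple_mul_le_simple_mul cs h hi hx
      obtain ⟨z, hxz, hzy, hz⟩ := ih h1 (by simpa using hne) hly
      rcases lt_or_gt_of_ne (cs.length_simple_mul_ne z i) with hz' | hz'
      · have h2 := BruhatLE.simple_mul_le cs hxz hz'
        rw [simple_mul_simple_cancel_left] at h2
        exact ⟨_, h2.trans hzy, simple_mul_bruhatLE cs hi, by omega⟩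
      · have h2 := BruhatLE.simple_mul_mono cs hxz hz'
        have h3 := BruhatLE.simple_mul_mono cs hzy (i := i)
          (by rwa [simple_mul_simple_cancel_left])
        rw [simple_mul_simple_cancel_left] at h2 h3
        refine ⟨_, h2, h3, ?_⟩
        rcases cs.length_simple_mul z i with h | h <;> omega
    · exact ⟨_, BruhatLE.le_simple_mul cs h hi hx, simple_mul_bruhatLE cs hi, by omega⟩

/-- Intervals of length two in the Bruhat order have at least two intermediate elements. -/
theorem exists_two_between {x y : W} (h : cs.BruhatLE x y)
    (hl : cs.length y = cs.length x + 2) :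
    ∃ a b, a ≠ b ∧ (cs.BruhatLE x a ∧ cs.BruhatLE a y ∧ cs.length a = cs.length x + 1) ∧
      cs.BruhatLE x b ∧ cs.BruhatLE b y ∧ cs.length b = cs.length x + 1 := by
  induction hn : cs.length y generalizing x y with
  | zero => omega
  | succ n ih =>
    obtain ⟨i, hi⟩ := exists_simple_mul_lt_of_bruhatLE_ne cs h (by rintro rfl; omega)
    have hly : cs.length (cs.simple i * y) = n := by
      rcases cs.length_simple_mul y i with h | h <;> omega
    rcases lt_or_gt_of_ne (cs.length_simple_mul_ne x i) with hx | hx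
    · have hlx : cs.length (cs.simple i * x) + 1 = cs.length x := by
        rcases cs.length_simple_mul x i with h | h <;> omega
      have h1 := BruhatLE.simple_mul_le_simple_mul cs h hi hx
      -- An intermediate element `a ≠ x` of `[s x, s y]` gives `s a` in the original interval.
      have up : ∀ a, cs.BruhatLE (cs.simple i * x) a → cs.BruhatLE a (cs.simple i * y) →
          cs.length a = cs.length (cs.simple i * x) + 1 → a ≠ x →
          cs.BruhatLE x (cs.simple i * a) ∧ cs.BruhatLE (cs.simple i * a) y ∧
            cs.length (cs.simple i * a) = cs.length x + 1 ∧
            cs.length a < cs.length (cs.simple i * a) := by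
        intro a hxa hay hla hne
        have hlt : cs.length a < cs.length (cs.simple i * a) := by
          rcases lt_or_gt_of_ne (cs.length_simple_mul_ne a i) with h' | h'
          · have h2 := BruhatLE.simple_mul_le cs hxa h'
            rw [simple_mul_simple_cancel_left] at h2
            exact absurd (BruhatLE.eq_of_length_le cs h2 (by omega)).symm hne
          · exact h'
        have h2 := BruhatLE.simple_mul_mono cs hxa hlt
        have h3 := BruhatLE.simple_mul_mono cs hay (i := i)
          (by rwa [simple_mul_simple_cancel_left])
        rw [simple_mul_simple_cancel_left] at h2 h3
        refine ⟨h2, h3, ?_, hlt⟩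
        rcases cs.length_simple_mul a i with h | h <;> omega
      obtain ⟨a, b, hab, ⟨ha1, ha2, ha3⟩, hb1, hb2, hb3⟩ := ih h1 (by omega) hly
      -- If `x` itself lies in `[s x, s y]`, then `s y` is the second intermediate element.
      have low : ∀ b, cs.BruhatLE (cs.simple i * x) b → cs.BruhatLE b (cs.simple i * y) →
          cs.length b = cs.length (cs.simple i * x) + 1 → b ≠ x →
          cs.BruhatLE x (cs.simple i * y) → ∃ a b, a ≠ b ∧
            (cs.BruhatLE x a ∧ cs.BruhatLE a y ∧ cs.length a = cs.length x + 1) ∧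
            cs.BruhatLE x b ∧ cs.BruhatLE b y ∧ cs.length b = cs.length x + 1 := by
        intro b hb1 hb2 hb3 hb hxy
        obtain ⟨h2, h3, h4, h5⟩ := up b hb1 hb2 hb3 hb
        refine ⟨cs.simple i * y, cs.simple i * b, ?_, ⟨hxy, simple_mul_bruhatLE cs hi, by omega⟩,
          h2, h3, h4⟩
        intro he
        rw [mul_right_inj] at he
        subst he
        omega
      by_cases hax : a = x
      · subst hax
        exact low b hb1 hb2 hb3 hab.symm ha2
      · by_cases hbx : b = x
        · subst hbx
          exact low a ha1 ha2 ha3 hab hb2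
        · obtain ⟨h2, h3, h4, -⟩ := up a ha1 ha2 ha3 hax
          obtain ⟨h5, h6, h7, -⟩ := up b hb1 hb2 hb3 hbx
          exact ⟨_, _, by simpa using hab, ⟨h2, h3, h4⟩, h5, h6, h7⟩
    · have h1 := BruhatLE.le_simple_mul cs h hi hx
      have h2 := BruhatLE.simple_mul_le cs h hi
      refine ⟨cs.simple i * x, cs.simple i * y, ?_, ⟨bruhatLE_simple_mul cs hx, h2, ?_⟩, h1,
        simple_mul_bruhatLE cs hi, by omega⟩
      · intro he
        rw [mul_right_inj] at he
        subst he
        omega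
      · rcases cs.length_simple_mul x i with h | h <;> omega

theorem finite_setOf_bruhatLE (y : W) : {x | cs.BruhatLE x y}.Finite := by
  obtain ⟨ω, rfl⟩ := cs.wordProd_surjective y
  refine ((List.finite_toSet ω.sublists).image cs.wordProd).subset ?_
  intro x hx
  obtain ⟨τ, hτ, rfl⟩ := exists_sublist_of_bruhatLE cs hx
  exact ⟨τ, List.mem_sublists.2 hτ, rfl⟩

/-- The left downward Demazure product exists: if `s w < w` and `m` is the minimum for `s w`, then
by lifting the smaller of `m` and `s m` is the minimum for `w`. -/
theorem exists_isLeftDownwardDemazure (w v : W) : ∃ m, cs.IsLeftDownwardDemazure w v m := by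
  induction hn : cs.length w generalizing w with
  | zero =>
    rw [cs.length_eq_zero_iff] at hn
    subst hn
    refine ⟨v, ⟨1, .refl, by simp⟩, fun w' hw' => ?_⟩
    rw [BruhatLE.eq_of_length_le cs hw' (by simp)]
    simpa using .refl
  | succ n ih =>
    obtain ⟨i, hi⟩ := cs.exists_leftDescent_of_ne_one (w := w) (by rintro rfl; simp at hn)
    have hi' : cs.length (cs.simple i * w) < cs.length w := hi
    have hlw : cs.length (cs.simple i * w) = n := by
      rcases cs.length_simple_mul w i with h | h <;> omega
    obtain ⟨m, ⟨w', hw', rfl⟩, hmin⟩ := ih _ hlw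
    have hsw := simple_mul_bruhatLE cs hi'
    have lift : cs.length (cs.simple i * w) < cs.length (cs.simple i * (cs.simple i * w)) := by
      rwa [simple_mul_simple_cancel_left]
    -- The minimum lies below everything as soon as it lies below `a v` and `s a v` for `a ≤ s w`.
    have red : ∀ m', (∀ z, cs.BruhatLE (w' * v) z → cs.BruhatLE m' z ∧
        cs.BruhatLE m' (cs.simple i * z)) → ∀ a, cs.BruhatLE a w → cs.BruhatLE m' (a * v) := by
      intro m' hm' a ha
      rcases BruhatLE.le_or_simple_mul_le cs ha hi' with h | h
      · exact (hm' _ (hmin a h)).1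
      · have := (hm' _ (hmin _ h)).2
        rwa [mul_assoc, simple_mul_simple_cancel_left] at this
    rcases lt_or_gt_of_ne (cs.length_simple_mul_ne (w' * v) i) with h | h
    · refine ⟨cs.simple i * (w' * v), ⟨cs.simple i * w', ?_, by rw [mul_assoc]⟩, red _ ?_⟩
      · have := BruhatLE.simple_mul_mono cs hw' lift
        rwa [simple_mul_simple_cancel_left] at this
      · intro z hz
        refine ⟨(simple_mul_bruhatLE cs h).trans hz, ?_⟩
        rcases lt_or_gt_of_ne (cs.length_simple_mul_ne z i) with h' | h'
        · exact BruhatLE.simple_mul_le_simple_mul cs hz h' h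
        · exact BruhatLE.simple_mul_mono cs hz h'
    · refine ⟨w' * v, ⟨w', hw'.trans hsw, rfl⟩, red _ ?_⟩
      intro z hz
      refine ⟨hz, ?_⟩
      rcases lt_or_gt_of_ne (cs.length_simple_mul_ne z i) with h' | h'
      · exact BruhatLE.le_simple_mul cs hz h' h
      · exact hz.trans (bruhatLE_simple_mul cs h')

/-- The condition `w ∘ₗ v ≤ u` in terms of products of elements below `w⁻¹` and `u`. -/
theorem exists_isLeftDownwardDemazure_le_iff (w v u : W) :
    (∃ m, cs.IsLeftDownwardDemazure w v m ∧ cs.BruhatLE m u) ↔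
      ∃ w' u', cs.BruhatLE w' w ∧ cs.BruhatLE u' u ∧ v = w'⁻¹ * u' := by
  constructor
  · rintro ⟨m, ⟨⟨w', hw', rfl⟩, -⟩, hm⟩
    exact ⟨w', w' * v, hw', hm, by simp⟩
  · rintro ⟨w', u', hw', hu', rfl⟩
    obtain ⟨m, hm⟩ := exists_isLeftDownwardDemazure cs w (w'⁻¹ * u')
    refine ⟨m, hm, ?_⟩
    have := hm.2 w' hw'
    rw [mul_inv_cancel_left] at this
    exact this.trans hu'

end CoxeterSystem

/-! ### Chain shellings -/

/-- `c 0, c 1, …, c n` is a descending chain of `r`-steps from `a` to `b`. The sequence is continued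
by the constant `b`, so that it is determined by its terms of index at most `n`. -/
structure IsDescChain {P : Type*} (r : P → P → Prop) (n : ℕ) (a b : P) (c : ℕ → P) : Prop where
  zero : c 0 = a
  rel : ∀ i < n, r (c (i + 1)) (c i)
  last : ∀ i, n ≤ i → c i = b

/-- A ranking of descending chains by keys such that every chain `c` is determined, among the chains
of at most the same key, by its entries at those positions where a single entry can be exchanged
with a decrease of the key. Enumerating the chains by increasing key is then a shelling. -/
def IsChainShelling {P α : Type*} [LT α] [LE α] (r : P → P → Prop) (n : ℕ) (a b : P)
    (key : (ℕ → P) → α) : Prop :=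
  ∀ c c', IsDescChain r n a b c → IsDescChain r n a b c' → key c' ≤ key c →
    (∀ i z, 0 < i → i < n → IsDescChain r n a b (Function.update c i z) →
      key (Function.update c i z) < key c → c' i = c i) → c' = c

theorem IsDescChain.update {P : Type*} {r : P → P → Prop} {n : ℕ} {a b : P} {c : ℕ → P}
    (h : IsDescChain r n a b c) {i : ℕ} {z : P} (hi : 0 < i) (hin : i < n)
    (h1 : r z (c (i - 1))) (h2 : r (c (i + 1)) z) :
    IsDescChain r n a b (Function.update c i z) where
  zero := by rw [Function.update_of_ne hi.ne, h.zero]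
  rel j hj := by
    by_cases hji : j = i
    · subst hji
      rwa [Function.update_of_ne (by omega), Function.update_self]
    · by_cases hji' : j + 1 = i
      · subst hji'
        rwa [Function.update_self, Function.update_of_ne (by omega)]
      · rw [Function.update_of_ne hji', Function.update_of_ne hji]
        exact h.rel j hj
  last j hj := by rw [Function.update_of_ne (by omega), h.last j hj]

namespace CoxeterSystem

variable {B W : Type*} [Group W] {M : CoxeterMatrix B} (cs : CoxeterSystem M W)

/-! ### Deleting letters from reduced words -/

/-- `x` is covered by `y` in the Bruhat order. -/
def BruhatCov (x y : W) : Prop := cs.BruhatLE x y ∧ cs.length x + 1 = cs.length y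

theorem BruhatCov.exists_eraseIdx {x : W} {ω : List B} (h : cs.BruhatCov x (cs.wordProd ω)) :
    ∃ j < ω.length, x = cs.wordProd (ω.eraseIdx j) := by
  obtain ⟨hle, hl⟩ := h
  rcases Relation.ReflTransGen.cases_tail hle with he | ⟨b, hxb, t, ht, he, hlt⟩
  · rw [← he] at hl
    omega
  · obtain rfl := BruhatLE.eq_of_length_le cs hxb (by omega)
    have hx : x = cs.wordProd ω * t := by rw [he, mul_assoc, ht.mul_self, mul_one]
    obtain ⟨j, hj, hj'⟩ := exists_eraseIdx_of_length_mul_lt cs ht (by rwa [← hx])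
    exact ⟨j, hj, hx.trans hj'⟩

theorem isReduced_eraseIdx_of_length {ω : List B} {j : ℕ} (hj : j < ω.length)
    (h : cs.length (cs.wordProd (ω.eraseIdx j)) + 1 = ω.length) :
    cs.IsReduced (ω.eraseIdx j) := by
  rw [IsReduced, List.length_eraseIdx_of_lt hj]
  omega

theorem IsReduced.bruhatCov_eraseIdx {ω : List B} (hω : cs.IsReduced ω) {j : ℕ}
    (hj : j < ω.length) (h : cs.IsReduced (ω.eraseIdx j)) :
    cs.BruhatCov (cs.wordProd (ω.eraseIdx j)) (cs.wordProd ω) := by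
  refine ⟨bruhatLE_of_sublist cs (List.eraseIdx_sublist _ _) hω, ?_⟩
  rw [h.eq, hω.eq, List.length_eraseIdx_of_lt hj]
  omega

theorem IsReduced.eraseIdx_injective {ω : List B} (hω : cs.IsReduced ω) {j k : ℕ}
    (hj : j < ω.length) (hk : k < ω.length)
    (h : cs.wordProd (ω.eraseIdx j) = cs.wordProd (ω.eraseIdx k)) : j = k := by
  rw [← wordProd_mul_getD_rightInvSeq, ← wordProd_mul_getD_rightInvSeq, mul_right_inj,
    List.getD_eq_getElem _ _ (by simpa using hj), List.getD_eq_getElem _ _ (by simpa using hk)] at h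
  exact (hω.nodup_rightInvSeq.getElem_inj_iff).1 h

/-- The reflection attached to the letter `i` after the prefix `A` lengthens `A D` and shortens
`A i C`, so that these words cannot have the same product. -/
theorem wordProd_append_cons_ne {A C D : List B} {i : B} (hC : cs.IsReduced (A ++ i :: C))
    (hD : cs.IsReduced (A ++ D)) (hD' : cs.IsReduced (A ++ i :: D)) :
    cs.wordProd (A ++ i :: C) ≠ cs.wordProd (A ++ D) := by
  intro h
  have h1 := hD.eq
  have h2 := hD'.eq
  have h3 := cs.length_wordProd_le (A ++ C)
  have h4 : cs.wordProd (A ++ i :: D) = cs.wordProd (A ++ C) := by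
    simp only [wordProd_append, wordProd_cons] at h ⊢
    rw [mul_right_inj] at h
    rw [← h, simple_mul_simple_cancel_left]
  rw [← h, hC.eq] at h1
  rw [h4] at h2
  simp only [List.length_append, List.length_cons] at *
  omega

/-- The mirror image of `wordProd_append_cons_ne`. -/
theorem wordProd_append_cons_ne' {A C D : List B} {i : B} (hC : cs.IsReduced (C ++ i :: A))
    (hD : cs.IsReduced (D ++ A)) (hD' : cs.IsReduced (D ++ i :: A)) :
    cs.wordProd (C ++ i :: A) ≠ cs.wordProd (D ++ A) := by
  intro h
  refine wordProd_append_cons_ne cs (A := A.reverse) (C := C.reverse) (D := D.reverse) (i := i)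
    ?_ ?_ ?_ ?_
  · simpa using hC.reverse
  · simpa using hD.reverse
  · simpa using hD'.reverse
  · have := congrArg (·⁻¹) h
    simp only [← wordProd_reverse] at this
    simpa using this

theorem wordProd_ne_of_take_eq {σ τ : List B} {l : ℕ} (hl : l < σ.length) (hσ : cs.IsReduced σ)
    (hσ' : cs.IsReduced (σ.eraseIdx l)) (hτ : cs.IsReduced τ)
    (h : τ.take (l + 1) = σ.take (l + 1)) :
    cs.wordProd τ ≠ cs.wordProd (σ.eraseIdx l) := by
  have e1 : σ = σ.take l ++ σ[l] :: σ.drop (l + 1) := by simp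
  have e2 : σ.eraseIdx l = σ.take l ++ σ.drop (l + 1) := List.eraseIdx_eq_take_drop_succ _ _
  have e3 : τ = σ.take l ++ σ[l] :: τ.drop (l + 1) := by
    conv_lhs => rw [← List.take_append_drop (l + 1) τ, h, List.take_succ_eq_append_getElem hl,
      List.append_assoc, List.singleton_append]
  rw [e2, e3]
  refine wordProd_append_cons_ne cs ?_ ?_ ?_
  · rwa [← e3]
  · rwa [← e2]
  · rwa [← e1]

/-- A chain of coatoms read off a word: `DeletionChain ω js τ` means that deleting successively the
letters at the positions `js` (each counted in the current word) leads from `ω` to `τ`, through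
reduced words. -/
inductive DeletionChain : List B → List ℕ → List B → Prop
  | nil (ω : List B) : DeletionChain ω [] ω
  | cons {ω τ : List B} {j : ℕ} {js : List ℕ} (hj : j < ω.length)
      (hr : cs.IsReduced (ω.eraseIdx j)) (h : DeletionChain (ω.eraseIdx j) js τ) :
      DeletionChain ω (j :: js) τ

variable {cs}

theorem DeletionChain.snoc {ω σ : List B} {js : List ℕ} {j : ℕ} (h : cs.DeletionChain ω js σ)
    (hj : j < σ.length) (hr : cs.IsReduced (σ.eraseIdx j)) :
    cs.DeletionChain ω (js ++ [j]) (σ.eraseIdx j) := by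
  induction h with
  | nil ω => exact .cons hj hr (.nil _)
  | cons hj' hr' _ ih => exact .cons hj' hr' (ih hj hr)

theorem DeletionChain.exists_of_snoc {ω τ : List B} {js : List ℕ} {j : ℕ}
    (h : cs.DeletionChain ω (js ++ [j]) τ) :
    ∃ σ, cs.DeletionChain ω js σ ∧ j < σ.length ∧ cs.IsReduced (σ.eraseIdx j) ∧
      τ = σ.eraseIdx j := by
  induction js generalizing ω with
  | nil =>
    cases h with
    | cons hj hr h =>
      cases h
      exact ⟨ω, .nil _, hj, hr, rfl⟩
  | cons k js ih =>
    cases h with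
    | cons hj hr h =>
      obtain ⟨σ, h1, h2, h3, h4⟩ := ih h
      exact ⟨σ, .cons hj hr h1, h2, h3, h4⟩

theorem DeletionChain.isReduced {ω τ : List B} {js : List ℕ} (h : cs.DeletionChain ω js τ)
    (hω : cs.IsReduced ω) : cs.IsReduced τ := by
  induction h with
  | nil => exact hω
  | cons _ hr _ ih => exact ih hr

theorem DeletionChain.sublist {ω τ : List B} {js : List ℕ} (h : cs.DeletionChain ω js τ) :
    τ.Sublist ω := by
  induction h with
  | nil => exact .refl _
  | cons _ _ _ ih => exact ih.trans (List.eraseIdx_sublist _ _)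

theorem DeletionChain.length_add {ω τ : List B} {js : List ℕ} (h : cs.DeletionChain ω js τ) :
    τ.length + js.length = ω.length := by
  induction h with
  | nil => simp
  | cons hj _ _ ih =>
    rw [List.length_eraseIdx_of_lt hj] at ih
    simp only [List.length_cons]
    omega

theorem DeletionChain.take_eq {ω τ : List B} {js : List ℕ} (h : cs.DeletionChain ω js τ) {n : ℕ}
    (hn : ∀ j ∈ js, n ≤ j) : τ.take n = ω.take n := by
  induction h with
  | nil => rfl
  | @cons ω τ j js _ _ _ ih =>
    rw [ih fun k hk => hn k (List.mem_cons_of_mem _ hk), List.take_eraseIdx_eq_take_of_le]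
    exact hn j List.mem_cons_self

variable (cs)

/-- Deletion chains with strictly decreasing positions are determined by their end: the leftmost
deleted letter is the last one to be deleted, and it is recognised from the product by
`wordProd_ne_of_take_eq`. -/
theorem DeletionChain.eq_of_pairwise {ω : List B} (hω : cs.IsReduced ω) {js js' : List ℕ}
    {τ τ' : List B} (h : cs.DeletionChain ω js τ) (h' : cs.DeletionChain ω js' τ')
    (hjs : js.Pairwise (· > ·)) (hjs' : js'.Pairwise (· > ·))
    (he : cs.wordProd τ = cs.wordProd τ') : js = js' := by
  have hlen : js.length = js'.length := by
    have h1 := h.length_add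
    have h2 := h'.length_add
    have h3 := congrArg cs.length he
    rw [(h.isReduced hω).eq, (h'.isReduced hω).eq] at h3
    omega
  induction js using List.reverseRecOn generalizing js' τ τ' with
  | nil => exact (List.length_eq_zero_iff.1 hlen.symm).symm
  | append_singleton ks j ih =>
    obtain rfl | ⟨ks', j', rfl⟩ := List.eq_nil_or_concat' js'
    · simp at hlen
    obtain ⟨σ, hσ, hj, hr, rfl⟩ := h.exists_of_snoc
    obtain ⟨σ', hσ', hj', hr', rfl⟩ := h'.exists_of_snoc
    simp only [List.pairwise_append, List.pairwise_singleton, List.mem_singleton, forall_eq,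
      true_and] at hjs hjs'
    have key : ∀ {ks ks' : List ℕ} {j j' : ℕ} {σ σ' : List B}, cs.DeletionChain ω ks σ →
        cs.DeletionChain ω ks' σ' → j < σ.length → cs.IsReduced (σ.eraseIdx j) →
        cs.IsReduced (σ'.eraseIdx j') → (∀ a ∈ ks, a > j) → (∀ a ∈ ks', a > j') → j < j' →
        cs.wordProd (σ.eraseIdx j) ≠ cs.wordProd (σ'.eraseIdx j') := by
      intro ks ks' j j' σ σ' hσ hσ' hj hr hr' hks hks' hlt he
      refine wordProd_ne_of_take_eq cs hj (hσ.isReduced hω) hr hr' ?_ he.symm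
      rw [List.take_eraseIdx_eq_take_of_le _ _ _ (by omega), hσ.take_eq, hσ'.take_eq]
      · intro a ha
        have := hks' a ha
        omega
      · exact fun a ha => hks a ha
    have hjj : j = j' := by
      rcases lt_trichotomy j j' with hlt | h | hlt
      · exact absurd he (key hσ hσ' hj hr hr' hjs.2 hjs'.2 hlt)
      · exact h
      · exact absurd he.symm (key hσ' hσ hj' hr' hr hjs'.2 hjs.2 hlt)
    subst hjj
    have htake : σ.take (j + 1) = σ'.take (j + 1) := by
      rw [hσ.take_eq fun a ha => hjs.2 a ha, hσ'.take_eq fun a ha => hjs'.2 a ha]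
    rw [List.take_succ_eq_append_getElem hj, List.take_succ_eq_append_getElem hj'] at htake
    obtain ⟨hA, hi⟩ := List.append_inj' htake rfl
    have hprod : cs.wordProd σ = cs.wordProd σ' := by
      rw [List.eraseIdx_eq_take_drop_succ, List.eraseIdx_eq_take_drop_succ, wordProd_append,
        wordProd_append, hA, mul_right_inj] at he
      rw [← List.take_append_drop (j + 1) σ, ← List.take_append_drop (j + 1) σ', wordProd_append,
        wordProd_append, he, List.take_succ_eq_append_getElem hj,
        List.take_succ_eq_append_getElem hj', hA, hi]
    rw [ih hσ hσ' hjs.1 hjs'.1 hprod (by simpa using hlen)]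

theorem drop_eraseIdx_eraseIdx {α : Type*} {l : List α} {j i n : ℕ} (hji : j ≤ i) (hin : i ≤ n) :
    ((l.eraseIdx j).eraseIdx i).drop n = l.drop (n + 2) := by
  apply List.ext_getElem?
  intro k
  rw [List.getElem?_drop, List.getElem?_drop, List.getElem?_eraseIdx_of_ge (by omega),
    List.getElem?_eraseIdx_of_ge (by omega)]
  congr 1
  omega

theorem eq_of_le_of_eraseIdx_eraseIdx {ω : List B} (hω : cs.IsReduced ω) {j i j' i' : ℕ}
    (hj : j < ω.length) (hj' : j' < ω.length) (hi : i < (ω.eraseIdx j).length)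
    (hi' : i' < (ω.eraseIdx j').length) (hji : j ≤ i) (hji' : j' ≤ i')
    (hrj : cs.IsReduced (ω.eraseIdx j)) (hrj' : cs.IsReduced (ω.eraseIdx j'))
    (hri : cs.IsReduced ((ω.eraseIdx j).eraseIdx i))
    (hri' : cs.IsReduced ((ω.eraseIdx j').eraseIdx i'))
    (he : cs.wordProd ((ω.eraseIdx j).eraseIdx i) = cs.wordProd ((ω.eraseIdx j').eraseIdx i')) :
    j = j' := by
  have hgetE : ∀ {j i : ℕ} (hi : i < (ω.eraseIdx j).length) (_ : j ≤ i),
      (ω.eraseIdx j).drop i = ω.drop (i + 1) := by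
    intro j i hi hji
    apply List.ext_getElem?
    intro k
    rw [List.getElem?_drop, List.getElem?_drop, List.getElem?_eraseIdx_of_ge (by omega)]
    congr 1
    omega
  have key : ∀ {j i j' i' : ℕ}, j < ω.length → i < (ω.eraseIdx j).length → j ≤ i → j' ≤ i' →
      cs.IsReduced (ω.eraseIdx j) → cs.IsReduced ((ω.eraseIdx j).eraseIdx i) →
      cs.IsReduced ((ω.eraseIdx j').eraseIdx i') → i' < i →
      cs.wordProd ((ω.eraseIdx j).eraseIdx i) ≠ cs.wordProd ((ω.eraseIdx j').eraseIdx i') := by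
    intro j i j' i' hj hi hji hji' hrj hri hri' hlt he
    have e1 : ω.eraseIdx j = (ω.eraseIdx j).take i ++
        (ω.eraseIdx j)[i] :: (ω.eraseIdx j).drop (i + 1) := by simp
    have e2 := List.eraseIdx_eq_take_drop_succ (ω.eraseIdx j) i
    have e3 : (ω.eraseIdx j').eraseIdx i' = ((ω.eraseIdx j').eraseIdx i').take (i - 1) ++
        (ω.eraseIdx j)[i] :: (ω.eraseIdx j).drop (i + 1) := by
      rw [← List.drop_eq_getElem_cons hi, hgetE hi hji,
        show i + 1 = i - 1 + 2 by omega, ← drop_eraseIdx_eraseIdx hji' (by omega),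
        List.take_append_drop]
    refine wordProd_append_cons_ne' cs ?_ ?_ ?_ ((congrArg cs.wordProd e3).symm.trans
      (he.symm.trans (congrArg cs.wordProd e2)))
    · rwa [← e3]
    · rwa [← e2]
    · rwa [← e1]
  have hii : i = i' := by
    rcases lt_trichotomy i' i with hlt | h | hlt
    · exact absurd he (key hj hi hji hji' hrj hri hri' hlt)
    · exact h.symm
    · exact absurd he.symm (key hj' hi' hji' hji hrj' hri' hri hlt)
  subst hii
  refine hω.eraseIdx_injective cs hj hj' ?_
  have hd := (hgetE hi hji).trans (hgetE hi' hji').symm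
  rw [List.drop_eq_getElem_cons hi, List.drop_eq_getElem_cons hi'] at hd
  obtain ⟨hd1, hd2⟩ := List.cons.inj hd
  rw [List.eraseIdx_eq_take_drop_succ (ω.eraseIdx j), List.eraseIdx_eq_take_drop_succ
    (ω.eraseIdx j'), wordProd_append, wordProd_append, hd2, mul_left_inj] at he
  rw [← List.take_append_drop i (ω.eraseIdx j), ← List.take_append_drop i (ω.eraseIdx j'),
    wordProd_append, wordProd_append, he, hgetE hi hji, hgetE hi' hji']

/-- A chain of length two whose second deletion is to the right of the first one can be replaced by
a chain whose first deletion is further to the right. -/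
theorem exists_eraseIdx_gt_of_le {ω : List B} (hω : cs.IsReduced ω) {j i : ℕ}
    (hj : j < ω.length) (hi : i < (ω.eraseIdx j).length) (hji : j ≤ i)
    (hrj : cs.IsReduced (ω.eraseIdx j)) (hri : cs.IsReduced ((ω.eraseIdx j).eraseIdx i)) :
    ∃ k, j < k ∧ k < ω.length ∧ cs.IsReduced (ω.eraseIdx k) ∧
      cs.BruhatLE (cs.wordProd ((ω.eraseIdx j).eraseIdx i)) (cs.wordProd (ω.eraseIdx k)) := by
  have h1 := hω.bruhatCov_eraseIdx cs hj hrj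
  have h2 := hrj.bruhatCov_eraseIdx cs hi hri
  obtain ⟨c, hcj, hc1, hc2, hc3⟩ : ∃ c, c ≠ cs.wordProd (ω.eraseIdx j) ∧
      cs.BruhatLE (cs.wordProd ((ω.eraseIdx j).eraseIdx i)) c ∧ cs.BruhatLE c (cs.wordProd ω) ∧
      cs.length c = cs.length (cs.wordProd ((ω.eraseIdx j).eraseIdx i)) + 1 := by
    obtain ⟨a, b, hab, ha, hb⟩ := exists_two_between cs (h2.1.trans h1.1) (by
      have := h1.2
      have := h2.2
      omega)
    by_cases haj : a = cs.wordProd (ω.eraseIdx j)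
    · exact ⟨b, fun hbj => hab (haj.trans hbj.symm), hb⟩
    · exact ⟨a, haj, ha⟩
  have h1' := h1.2
  have h2' := h2.2
  obtain ⟨k, hk, rfl⟩ := BruhatCov.exists_eraseIdx cs ⟨hc2, by omega⟩
  have hrk : cs.IsReduced (ω.eraseIdx k) :=
    isReduced_eraseIdx_of_length cs hk (by rw [← hω.eq]; omega)
  obtain ⟨l, hl, he⟩ := BruhatCov.exists_eraseIdx cs ⟨hc1, hc3.symm⟩
  have hrl : cs.IsReduced ((ω.eraseIdx k).eraseIdx l) :=
    isReduced_eraseIdx_of_length cs hl (by rw [← hrk.eq, ← he, hc3])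
  refine ⟨k, ?_, hk, hrk, hc1⟩
  by_contra hkj
  rcases le_or_gt k l with hkl | hkl
  · exact hcj (by
      rw [eq_of_le_of_eraseIdx_eraseIdx cs hω hj hk hi hl hji hkl hrj hrk hri hrl he])
  · have hkj' : k < j := lt_of_le_of_ne (not_lt.1 hkj) (by rintro rfl; exact hcj rfl)
    refine wordProd_ne_of_take_eq cs hl hrk hrl hri ?_ he
    rw [List.take_eraseIdx_eq_take_of_le _ _ _ (by omega),
      List.take_eraseIdx_eq_take_of_le _ _ _ (by omega),
      List.take_eraseIdx_eq_take_of_le _ _ _ (by omega)]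

/-- Deleting at each step the rightmost letter whose deletion leaves an element above `x` gives a
deletion chain with strictly decreasing positions, by `exists_eraseIdx_gt_of_le`. -/
theorem exists_deletionChain_pairwise {ω : List B} (hω : cs.IsReduced ω) {x : W}
    (hx : cs.BruhatLE x (cs.wordProd ω)) :
    ∃ js τ, cs.DeletionChain ω js τ ∧ cs.wordProd τ = x ∧ js.Pairwise (· > ·) ∧
      ∀ k < ω.length, cs.IsReduced (ω.eraseIdx k) →
        cs.BruhatLE x (cs.wordProd (ω.eraseIdx k)) → ∃ j ∈ js.head?, k ≤ j := by
  classical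
  induction hn : ω.length generalizing ω with
  | zero =>
    refine ⟨[], ω, .nil _, ?_, .nil, fun k hk => by omega⟩
    refine (BruhatLE.eq_of_length_le cs hx ?_).symm
    rw [hω.eq, hn]
    omega
  | succ n ih =>
    by_cases hne : x = cs.wordProd ω
    · refine ⟨[], ω, .nil _, hne.symm, .nil, fun k hk hr hle => ?_⟩
      have h1 := (hω.bruhatCov_eraseIdx cs (by omega) hr).2
      have h2 := BruhatLE.length_le cs hle
      rw [hne] at h2
      omega
    · obtain ⟨z, hxz, hz⟩ := exists_bruhat_coatom cs hx hne
      obtain ⟨j₀, hj₀, rfl⟩ := BruhatCov.exists_eraseIdx cs hz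
      have hr₀ : cs.IsReduced (ω.eraseIdx j₀) :=
        isReduced_eraseIdx_of_length cs hj₀ (by rw [hz.2, hω.eq])
      obtain ⟨j, hj, hmax⟩ := ((Finset.range ω.length).filter fun k =>
        cs.IsReduced (ω.eraseIdx k) ∧ cs.BruhatLE x (cs.wordProd (ω.eraseIdx k))).exists_max_image
          id ⟨j₀, by simp [hj₀, hr₀, hxz]⟩
      simp only [Finset.mem_filter, Finset.mem_range, id, and_imp] at hj hmax
      obtain ⟨hjl, hrj, hxj⟩ := hj
      obtain ⟨js, τ, hch, rfl, hpw, hhead⟩ := ih hrj hxj (by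
        rw [List.length_eraseIdx_of_lt hjl]; omega)
      refine ⟨j :: js, τ, .cons hjl hrj hch, rfl, ?_, fun k hk hr hle =>
        ⟨j, by simp, hmax k (by omega) hr hle⟩⟩
      refine List.pairwise_cons.2 ⟨?_, hpw⟩
      cases hch with
      | nil => simp
      | @cons _ _ i js hi hri hch =>
        have hij : i < j := by
          by_contra hij
          obtain ⟨k, hjk, hk, hrk, hle⟩ :=
            exists_eraseIdx_gt_of_le cs hω hjl hi (not_lt.1 hij) hrj hri
          have := hmax k hk hrk ((bruhatLE_of_sublist cs hch.sublist hri).trans hle)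
          omega
        intro a ha
        rcases List.mem_cons.1 ha with rfl | ha
        · exact hij
        · exact ((List.pairwise_cons.1 hpw).1 a ha).trans hij

/-- A deletion chain with strictly decreasing positions starts with the largest position that is
possible in view of its end. -/
theorem DeletionChain.le_head {ω : List B} (hω : cs.IsReduced ω) {j : ℕ} {js : List ℕ}
    {τ : List B} (h : cs.DeletionChain ω (j :: js) τ) (hjs : (j :: js).Pairwise (· > ·)) {k : ℕ}
    (hk : k < ω.length) (hr : cs.IsReduced (ω.eraseIdx k))
    (hle : cs.BruhatLE (cs.wordProd τ) (cs.wordProd (ω.eraseIdx k))) : k ≤ j := by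
  obtain ⟨js', τ', h', he, hpw, hhead⟩ :=
    exists_deletionChain_pairwise cs hω (bruhatLE_of_sublist cs h.sublist hω)
  have := DeletionChain.eq_of_pairwise cs hω h h' hjs hpw he.symm
  subst this
  obtain ⟨i, hi, hki⟩ := hhead k hk hr hle
  simp only [List.head?_cons, Option.mem_def, Option.some.injEq] at hi
  omega

/-! ### Lexicographic shelling of Bruhat intervals -/

open Classical in
/-- The position of a letter of `ω` whose deletion gives `x` (and `0` if there is none). -/
noncomputable def deletionIndex (ω : List B) (x : W) : ℕ :=
  if h : ∃ j < ω.length, x = cs.wordProd (ω.eraseIdx j) then h.choose else 0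

/-- The words obtained from `ω` by successive deletion of letters along the chain `m`. -/
noncomputable def chainWord (ω : List B) (m : ℕ → W) : ℕ → List B
  | 0 => ω
  | i + 1 => (chainWord ω m i).eraseIdx (deletionIndex cs (chainWord ω m i) (m (i + 1)))

/-- The position deleted in the `i`-th step of the chain `m`. -/
noncomputable def chainLabel (ω : List B) (m : ℕ → W) (i : ℕ) : ℕ :=
  deletionIndex cs (chainWord cs ω m i) (m (i + 1))

/-- The sequence of deleted positions, ordered lexicographically with larger positions first. -/
noncomputable def chainKey (ω : List B) (n : ℕ) (m : ℕ → W) : Lex (ℕ → ℕᵒᵈ) :=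
  toLex fun i => OrderDual.toDual (if i < n then chainLabel cs ω m i else 0)

theorem deletionIndex_spec {ω : List B} {x : W} (h : cs.BruhatCov x (cs.wordProd ω)) :
    deletionIndex cs ω x < ω.length ∧ x = cs.wordProd (ω.eraseIdx (deletionIndex cs ω x)) := by
  have h' := BruhatCov.exists_eraseIdx cs h
  rw [deletionIndex, dif_pos h']
  exact h'.choose_spec

theorem deletionIndex_eq {ω : List B} (hω : cs.IsReduced ω) {k : ℕ} (hk : k < ω.length)
    (hr : cs.IsReduced (ω.eraseIdx k)) :
    deletionIndex cs ω (cs.wordProd (ω.eraseIdx k)) = k := by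
  obtain ⟨h1, h2⟩ := deletionIndex_spec cs (hω.bruhatCov_eraseIdx cs hk hr)
  exact (hω.eraseIdx_injective cs hk h1 h2).symm

variable {cs} {ω : List B} {n : ℕ} {x : W} {m m' : ℕ → W}

theorem chainWord_spec (hω : cs.IsReduced ω)
    (hm : IsDescChain cs.BruhatCov n (cs.wordProd ω) x m) {i : ℕ} (hi : i ≤ n) :
    cs.IsReduced (chainWord cs ω m i) ∧ cs.wordProd (chainWord cs ω m i) = m i := by
  induction i with
  | zero => exact ⟨hω, hm.zero.symm⟩
  | succ i ih =>
    obtain ⟨h1, h2⟩ := ih (by omega)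
    have hc := hm.rel i (by omega)
    rw [← h2] at hc
    obtain ⟨h3, h4⟩ := deletionIndex_spec cs hc
    refine ⟨isReduced_eraseIdx_of_length cs h3 ?_, h4.symm⟩
    rw [← h4, hc.2, h1.eq]

theorem chainLabel_spec (hω : cs.IsReduced ω)
    (hm : IsDescChain cs.BruhatCov n (cs.wordProd ω) x m) {i : ℕ} (hi : i < n) :
    chainLabel cs ω m i < (chainWord cs ω m i).length ∧
      cs.IsReduced ((chainWord cs ω m i).eraseIdx (chainLabel cs ω m i)) ∧
      cs.wordProd ((chainWord cs ω m i).eraseIdx (chainLabel cs ω m i)) = m (i + 1) := by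
  have hc := hm.rel i hi
  rw [← (chainWord_spec hω hm hi.le).2] at hc
  exact ⟨(deletionIndex_spec cs hc).1, chainWord_spec hω hm (i := i + 1) hi⟩

theorem chainWord_congr {i : ℕ} (h : ∀ j ≤ i, m j = m' j) :
    chainWord cs ω m i = chainWord cs ω m' i := by
  induction i with
  | zero => rfl
  | succ i ih => rw [chainWord, chainWord, ih fun j hj => h j (by omega), h (i + 1) le_rfl]

theorem chainWord_congr_of_label {i : ℕ} (h : ∀ j < i, chainLabel cs ω m j = chainLabel cs ω m' j) :
    chainWord cs ω m i = chainWord cs ω m' i := by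
  induction i with
  | zero => rfl
  | succ i ih =>
    have h1 := h i (by omega)
    rw [chainLabel, chainLabel] at h1
    rw [chainWord, chainWord, h1, ih fun j hj => h j (by omega)]

theorem chainKey_lt_chainKey {i : ℕ} (hi : i < n)
    (h : ∀ j < i, chainLabel cs ω m' j = chainLabel cs ω m j)
    (hlt : chainLabel cs ω m i < chainLabel cs ω m' i) :
    chainKey cs ω n m' < chainKey cs ω n m := by
  refine ⟨i, fun j hj => ?_, ?_⟩
  · change OrderDual.toDual (if j < n then _ else _) = OrderDual.toDual (if j < n then _ else _)
    rw [h j hj]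
  · change OrderDual.toDual (if i < n then _ else _) < OrderDual.toDual (if i < n then _ else _)
    rwa [if_pos hi, if_pos hi, OrderDual.toDual_lt_toDual]

theorem chain_bruhatLE (hm : IsDescChain cs.BruhatCov n (cs.wordProd ω) x m) {i j : ℕ} (hij : i ≤ j)
    (hj : j ≤ n) : cs.BruhatLE (m j) (m i) := by
  induction j, hij using Nat.le_induction with
  | base => exact .refl
  | succ j hij ih => exact (hm.rel j (by omega)).1.trans (ih (by omega))

theorem deletionChain_segment (hω : cs.IsReduced ω)
    (hm : IsDescChain cs.BruhatCov n (cs.wordProd ω) x m) {a d : ℕ} (h : a + d ≤ n) :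
    cs.DeletionChain (chainWord cs ω m a)
      ((List.range d).map fun i => chainLabel cs ω m (a + i)) (chainWord cs ω m (a + d)) := by
  induction d with
  | zero => exact .nil _
  | succ d ih =>
    obtain ⟨h1, h2, -⟩ := chainLabel_spec hω hm (i := a + d) (by omega)
    rw [List.range_succ, List.map_append]
    exact (ih (by omega)).snoc h1 h2

/-- Where the labels of a chain fail to decrease, a single element can be exchanged so that the
chain becomes lexicographically smaller. -/
theorem exists_update_chainKey_lt (hω : cs.IsReduced ω)
    (hm : IsDescChain cs.BruhatCov n (cs.wordProd ω) x m) {i : ℕ} (hi : i + 1 < n)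
    (h : chainLabel cs ω m i ≤ chainLabel cs ω m (i + 1)) :
    ∃ z, IsDescChain cs.BruhatCov n (cs.wordProd ω) x (Function.update m (i + 1) z) ∧
      chainKey cs ω n (Function.update m (i + 1) z) < chainKey cs ω n m := by
  obtain ⟨hw, hwi⟩ := chainWord_spec hω hm (i := i) (by omega)
  obtain ⟨h1, h2, h3⟩ := chainLabel_spec hω hm (i := i) (by omega)
  obtain ⟨h4, h5, h6⟩ := chainLabel_spec hω hm (i := i + 1) (by omega)
  rw [show chainWord cs ω m (i + 1) =
    (chainWord cs ω m i).eraseIdx (chainLabel cs ω m i) from rfl] at h4 h5 h6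
  obtain ⟨k, hk, hkl, hr, hle⟩ := exists_eraseIdx_gt_of_le cs hw h1 h4 h h2 h5
  have hcov := hw.bruhatCov_eraseIdx cs hkl hr
  refine ⟨cs.wordProd ((chainWord cs ω m i).eraseIdx k), hm.update (by omega) hi ?_ ?_, ?_⟩
  · rwa [hwi] at hcov
  · rw [h6] at hle
    refine ⟨hle, ?_⟩
    have e1 := (hm.rel i (by omega)).2
    have e2 := (hm.rel (i + 1) hi).2
    have e3 := hcov.2
    rw [hwi] at e3
    omega
  · have hword : ∀ j ≤ i, chainWord cs ω (Function.update m (i + 1)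
        (cs.wordProd ((chainWord cs ω m i).eraseIdx k))) j = chainWord cs ω m j := fun j hj =>
      chainWord_congr fun l hl => Function.update_of_ne (by omega) _ _
    refine chainKey_lt_chainKey (i := i) (by omega) (fun j hj => ?_) ?_
    · rw [chainLabel, hword j hj.le, Function.update_of_ne (by omega), chainLabel]
    · rw [chainLabel.eq_1 cs ω (Function.update _ _ _), hword i le_rfl, Function.update_self,
        deletionIndex_eq cs hw hkl hr]
      exact hk

/-- Bruhat intervals are lexicographically shellable. A chain with decreasing labels is
lexicographically first, so beyond the first place where a smaller chain branches off there is a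
non-decrease of the labels before the two chains can meet again. -/
theorem isChainShelling_chainKey (hω : cs.IsReduced ω) :
    IsChainShelling cs.BruhatCov n (cs.wordProd ω) x (chainKey cs ω n) := by
  classical
  intro m m' hm hm' hkey hagree
  rcases hkey.eq_or_lt with heq | ⟨a, ha, hlt⟩
  · have hlab : ∀ i < n, chainLabel cs ω m' i = chainLabel cs ω m i := by
      intro i hi
      have := congrFun heq i
      simpa [chainKey, hi] using this
    funext i
    rcases le_total n i with hi | hi
    · rw [hm.last i hi, hm'.last i hi]
    · rw [← (chainWord_spec hω hm hi).2, ← (chainWord_spec hω hm' hi).2,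
        chainWord_congr_of_label fun j hj => hlab j (by omega)]
  · exfalso
    have han : a < n := by
      by_contra han
      simp [chainKey, han] at hlt
    replace hlt : chainLabel cs ω m a < chainLabel cs ω m' a := by
      simpa [chainKey, han] using hlt
    have hword : chainWord cs ω m' a = chainWord cs ω m a := by
      refine chainWord_congr_of_label fun j hj => ?_
      have := ha j hj
      simpa [chainKey, hj.trans han] using this
    have hex : ∃ d, a + (d + 1) = n ∨
        chainLabel cs ω m (a + d) ≤ chainLabel cs ω m (a + (d + 1)) :=
      ⟨n - a - 1, Or.inl (by omega)⟩
    -- The labels decrease strictly for `d` steps, up to the end or the first non-decrease.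
    obtain ⟨d, hd, hmin⟩ : ∃ d, (a + (d + 1) = n ∨
        chainLabel cs ω m (a + d) ≤ chainLabel cs ω m (a + (d + 1))) ∧
        ∀ i < d, a + (i + 1) ≠ n ∧ chainLabel cs ω m (a + (i + 1)) < chainLabel cs ω m (a + i) :=
      ⟨Nat.find hex, Nat.find_spec hex, fun i hi => by
        have := Nat.find_min hex hi
        push Not at this
        exact this⟩
    have hdn : a + (d + 1) ≤ n := by
      by_contra hdn
      exact (hmin (n - a - 1) (by omega)).1 (by omega)
    have hanti : ∀ i j, i < j → j < d + 1 →
        chainLabel cs ω m (a + j) < chainLabel cs ω m (a + i) := by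
      intro i j hij hj
      induction j, hij using Nat.le_induction with
      | base => exact (hmin i (by omega)).2
      | succ j hij ih => exact (hmin j (by omega)).2.trans (ih (by omega))
    have hmeet : m' (a + (d + 1)) = m (a + (d + 1)) := by
      rcases hdn.eq_or_lt with he | hlt'
      · rw [hm.last _ he.ge, hm'.last _ he.ge]
      · obtain ⟨z, hz, hz'⟩ := exists_update_chainKey_lt hω hm (i := a + d) (by omega)
          (hd.resolve_left (by omega))
        exact hagree _ z (by omega) hlt' hz hz'
    have hseg := deletionChain_segment hω hm hdn
    have hpw : ((List.range (d + 1)).map fun i => chainLabel cs ω m (a + i)).Pairwise (· > ·) := by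
      rw [List.pairwise_map]
      refine List.pairwise_lt_range.imp_of_mem ?_
      intro i j _ hj hij
      exact hanti i j hij (List.mem_range.1 hj)
    rw [List.range_succ_eq_map, List.map_cons] at hseg hpw
    obtain ⟨h1, h2, h3⟩ := chainLabel_spec hω hm' han
    rw [hword] at h1 h2 h3
    have := hseg.le_head cs (chainWord_spec hω hm han.le).1 hpw h1 h2 (by
      rw [(chainWord_spec hω hm hdn).2, ← hmeet, h3]
      exact chain_bruhatLE hm' (by omega) hdn)
    simp only [add_zero] at this
    omega

end CoxeterSystem

/-! ### From chain shellings to shellable posets -/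

open Classical in
/-- The set of elements of a descending chain of length `n`. -/
noncomputable def chainFace {R : Type*} (n : ℕ) (c : ℕ → R) : Finset R :=
  (Finset.range (n + 1)).image c

theorem mem_chainFace {R : Type*} {n : ℕ} {c : ℕ → R} {x : R} :
    x ∈ chainFace n c ↔ ∃ i ≤ n, c i = x := by
  simp [chainFace]

section Criterion

variable {R : Type*} [PartialOrder R]

theorem length_add_of_covBy_series {ρ : R → ℕ} (hρ : ∀ x y : R, x ⋖ y → ρ y = ρ x + 1)
    (c : RelSeries {p : R × R | p.1 ⋖ p.2}) : ρ c.head + c.length = ρ c.last := by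
  have h : ∀ i (hi : i < c.length + 1), ρ (c ⟨i, hi⟩) = ρ c.head + i := by
    intro i
    induction i with
    | zero => exact fun _ => rfl
    | succ i ih =>
      intro hi
      have h1 := hρ _ _ (c.step ⟨i, by omega⟩)
      have h2 := ih (by omega)
      simp only [Fin.castSucc_mk, Fin.succ_mk] at h1
      omega
  exact (h c.length (by omega)).symm

theorem isPurePoset_of_rank [Finite R] {ρ : R → ℕ} (hρ : ∀ x y : R, x ⋖ y → ρ y = ρ x + 1) :
    IsPurePoset R := by
  classical
  intro x y hxy
  constructor
  · have : Fintype R := Fintype.ofFinite R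
    have : LocallyFiniteOrder R := by
      classical
      have : DecidableLE R := Classical.decRel _
      exact Fintype.toLocallyFiniteOrder
    rw [le_iff_reflTransGen_covBy] at hxy
    induction hxy with
    | refl => exact ⟨RelSeries.singleton _ x, rfl, rfl⟩
    | tail _ hbc ih =>
      obtain ⟨c, rfl, rfl⟩ := ih
      exact ⟨c.snoc _ hbc, by simp, by simp⟩
  · rintro c c' ⟨rfl, rfl⟩ ⟨h1, h2⟩
    have h3 := length_add_of_covBy_series hρ c
    have h4 := length_add_of_covBy_series hρ c'
    rw [h1, h2] at h4
    omega

variable {n : ℕ} {a b : R} {ρ : R → ℕ} {c c' : ℕ → R}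

theorem IsDescChain.antitone (hc : IsDescChain (· ⋖ ·) n a b c) : Antitone c := by
  refine antitone_nat_of_succ_le fun i => ?_
  rcases lt_or_ge i n with hi | hi
  · exact (hc.rel i hi).le
  · rw [hc.last i hi, hc.last (i + 1) (by omega)]

theorem IsDescChain.rank_add (hρ : ∀ x y : R, x ⋖ y → ρ y = ρ x + 1)
    (hc : IsDescChain (· ⋖ ·) n a b c) {i : ℕ} (hi : i ≤ n) : ρ (c i) + i = ρ a := by
  induction i with
  | zero => rw [hc.zero, add_zero]
  | succ i ih =>
    have h1 := ih (by omega)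
    have h2 := hρ _ _ (hc.rel i (by omega))
    omega

theorem IsDescChain.eq_of_forall_comparable (hmono : StrictMono ρ)
    (hρ : ∀ x y : R, x ⋖ y → ρ y = ρ x + 1) (ha : ∀ x, x ≤ a) (hn : ρ a = n)
    (hc : IsDescChain (· ⋖ ·) n a b c) {z : R} (hz : ∀ i ≤ n, z ≤ c i ∨ c i ≤ z) :
    z = c (n - ρ z) := by
  have h1 : ρ z ≤ n := hn ▸ hmono.monotone (ha z)
  have h2 := hc.rank_add hρ (i := n - ρ z) (by omega)
  rcases hz (n - ρ z) (by omega) with h | h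
  · rcases h.eq_or_lt with h | h
    · exact h
    · have := hmono h
      omega
  · rcases h.eq_or_lt with h | h
    · exact h.symm
    · have := hmono h
      omega

theorem IsDescChain.eq_of_chainFace_eq (hρ : ∀ x y : R, x ⋖ y → ρ y = ρ x + 1)
    (hc : IsDescChain (· ⋖ ·) n a b c) (hc' : IsDescChain (· ⋖ ·) n a b c')
    (h : ∀ i ≤ n, c' i ∈ chainFace n c) : c' = c := by
  funext i
  rcases le_total n i with hi | hi
  · rw [hc.last i hi, hc'.last i hi]
  · obtain ⟨j, hj, he⟩ := mem_chainFace.1 (h i hi)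
    have h1 := hc.rank_add hρ hj
    have h2 := hc'.rank_add hρ hi
    rw [← he] at h2
    rw [← he, show j = i by omega]

theorem IsDescChain.maximal_chainFace (hmono : StrictMono ρ)
    (hρ : ∀ x y : R, x ⋖ y → ρ y = ρ x + 1) (ha : ∀ x, x ≤ a) (hn : ρ a = n)
    (hc : IsDescChain (· ⋖ ·) n a b c) : Maximal (· ∈ orderComplex R) (chainFace n c) := by
  refine ⟨⟨⟨c 0, mem_chainFace.2 ⟨0, by omega, rfl⟩⟩, ?_⟩, ?_⟩
  · intro x hx y hy _
    obtain ⟨i, -, rfl⟩ := mem_chainFace.1 (Finset.mem_coe.1 hx)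
    obtain ⟨j, -, rfl⟩ := mem_chainFace.1 (Finset.mem_coe.1 hy)
    rcases le_total i j with h | h
    · exact Or.inr (hc.antitone h)
    · exact Or.inl (hc.antitone h)
  · intro s hs hle z hz
    have := hc.eq_of_forall_comparable hmono hρ ha hn (z := z) fun i hi =>
      hs.2.total hz (hle (mem_chainFace.2 ⟨i, hi, rfl⟩))
    rw [this]
    exact mem_chainFace.2 ⟨_, by omega, rfl⟩

theorem mem_of_maximal_of_comparable {s : Finset R} (hs : Maximal (· ∈ orderComplex R) s) {z : R}
    (hz : ∀ x ∈ s, z ≤ x ∨ x ≤ z) : z ∈ s := by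
  classical
  have h : insert z s ∈ orderComplex R := by
    refine ⟨Finset.insert_nonempty _ _, ?_⟩
    rw [Finset.coe_insert]
    exact hs.1.2.insert fun x hx _ => hz x hx
  exact hs.2 h (Finset.subset_insert _ _) (Finset.mem_insert_self _ _)

theorem exists_covBy_of_maximal {s : Finset R} (hs : Maximal (· ∈ orderComplex R) s)
    (hb : ∀ x, b ≤ x) {x : R} (hx : x ∈ s) (hxb : x ≠ b) : ∃ y ∈ s, y ⋖ x := by
  classical
  have hbs : b ∈ s := mem_of_maximal_of_comparable hs fun x _ => Or.inl (hb x)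
  obtain ⟨y, hy⟩ := (s.filter (· < x)).exists_maximal
    ⟨b, by simpa [hbs] using lt_of_le_of_ne (hb x) (Ne.symm hxb)⟩
  have hys := Finset.mem_filter.1 hy.1
  refine ⟨y, hys.1, hys.2, fun z hyz hzx => ?_⟩
  have hz : z ∈ s := by
    refine mem_of_maximal_of_comparable hs fun w hw => ?_
    rcases hs.1.2.total hw hx with h | h
    · rcases h.eq_or_lt with rfl | h
      · exact Or.inl hzx.le
      · rcases hs.1.2.total hw hys.1 with h' | h'
        · exact Or.inr (h'.trans hyz.le)
        · exact Or.inr ((hy.2 (Finset.mem_filter.2 ⟨hw, h⟩) h').trans hyz.le)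
    · exact Or.inl (hzx.le.trans h)
  exact absurd (hy.2 (Finset.mem_filter.2 ⟨hz, hzx⟩) hyz.le) hyz.not_ge

theorem exists_isDescChain_of_maximal (hmono : StrictMono ρ)
    (hρ : ∀ x y : R, x ⋖ y → ρ y = ρ x + 1) (ha : ∀ x, x ≤ a) (hb : ∀ x, b ≤ x) (hn : ρ a = n)
    (hb0 : ρ b = 0) {s : Finset R} (hs : Maximal (· ∈ orderComplex R) s) :
    ∃ c, IsDescChain (· ⋖ ·) n a b c ∧ chainFace n c = s := by
  classical
  have hnext : ∀ x : R, ∃ y, (x ∈ s → x ≠ b → y ∈ s ∧ y ⋖ x) ∧ (x = b → y = b) := by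
    intro x
    by_cases h : x ∈ s ∧ x ≠ b
    · obtain ⟨y, hy⟩ := exists_covBy_of_maximal hs hb h.1 h.2
      exact ⟨y, fun _ _ => hy, fun h' => absurd h' h.2⟩
    · exact ⟨b, fun h1 h2 => absurd ⟨h1, h2⟩ h, fun _ => rfl⟩
  choose next hnext1 hnext2 using hnext
  let c : ℕ → R := fun i => next^[i] a
  have hsucc : ∀ i, c (i + 1) = next (c i) := fun i => Function.iterate_succ_apply' _ _ _
  have hstep : ∀ i ≤ n, c i ∈ s ∧ ρ (c i) + i = n := by
    intro i
    induction i with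
    | zero => exact fun _ => ⟨mem_of_maximal_of_comparable hs fun x _ => Or.inr (ha x), hn⟩
    | succ i ih =>
      intro hi
      obtain ⟨h1, h2⟩ := ih (by omega)
      obtain ⟨h3, h4⟩ := hnext1 (c i) h1 (by rintro h; rw [h] at h2; omega)
      have h5 := hρ _ _ h4
      rw [hsucc]
      exact ⟨h3, by omega⟩
  have hlast : ∀ i, n ≤ i → c i = b := by
    intro i hi
    induction i, hi using Nat.le_induction with
    | base =>
      have h1 := (hstep n le_rfl).2
      rcases (hb (c n)).eq_or_lt with h | h
      · exact h.symm
      · have := hmono h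
        omega
    | succ i hi ih => rw [hsucc, hnext2 _ ih]
  have hc : IsDescChain (· ⋖ ·) n a b c := by
    refine ⟨rfl, fun i hi => ?_, hlast⟩
    obtain ⟨h1, h2⟩ := hstep i hi.le
    rw [hsucc]
    exact (hnext1 (c i) h1 (by rintro h; rw [h] at h2; omega)).2
  refine ⟨c, hc, ?_⟩
  refine (hc.maximal_chainFace hmono hρ ha hn).eq_of_le hs.1 ?_
  intro x hx
  obtain ⟨i, hi, rfl⟩ := mem_chainFace.1 hx
  exact (hstep i hi).1

/-- A finite bounded graded poset with a chain shelling is shellable: the facets of the order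
complex are the descending chains from the top to the bottom, enumerated by increasing key. -/
theorem isShellablePoset_of_isChainShelling [Finite R] {α : Type*} [LinearOrder α]
    (hmono : StrictMono ρ) (hρ : ∀ x y : R, x ⋖ y → ρ y = ρ x + 1) (ha : ∀ x, x ≤ a)
    (hb : ∀ x, b ≤ x) (hn : ρ a = n) (hb0 : ρ b = 0) {key : (ℕ → R) → α}
    (hshell : IsChainShelling (· ⋖ ·) n a b key) : IsShellablePoset R := by
  classical
  refine ⟨inferInstance, isPurePoset_of_rank hρ, ?_⟩
  have hex : ∀ s : {s : Finset R // Maximal (· ∈ orderComplex R) s},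
      ∃ c, IsDescChain (· ⋖ ·) n a b c ∧ chainFace n c = s.1 := fun s =>
    exists_isDescChain_of_maximal hmono hρ ha hb hn hb0 s.2
  choose C hC hCs using hex
  let e := (Finite.equivFin {s : Finset R // Maximal (· ∈ orderComplex R) s}).symm
  let σ := Tuple.sort fun i => key (C (e i))
  have hsort : Monotone fun i => key (C (e (σ i))) := Tuple.monotone_sort fun i => key (C (e i))
  have hsurj : ∀ c, IsDescChain (· ⋖ ·) n a b c → ∃ i, C (e (σ i)) = c := by
    intro c hc
    have hmax := hc.maximal_chainFace hmono hρ ha hn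
    refine ⟨σ.symm (e.symm ⟨_, hmax⟩), ?_⟩
    rw [Equiv.apply_symm_apply, Equiv.apply_symm_apply]
    refine hc.eq_of_chainFace_eq hρ (hC _) fun i hi => ?_
    have : C ⟨_, hmax⟩ i ∈ chainFace n (C ⟨_, hmax⟩) := mem_chainFace.2 ⟨i, hi, rfl⟩
    rwa [hCs] at this
  refine ⟨_, fun i => (e (σ i)).1, ?_, ?_, ?_⟩
  · intro i j hij
    exact σ.injective (e.injective (Subtype.ext hij))
  · ext s
    constructor
    · rintro ⟨i, rfl⟩
      exact (e (σ i)).2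
    · intro hs
      exact ⟨σ.symm (e.symm ⟨s, hs⟩), by simp⟩
  · intro k hk
    -- Every earlier facet misses a vertex whose removal gives a face of an earlier facet.
    have hcore : ∀ i < k, ∃ x ∈ (e (σ k)).1, x ∉ (e (σ i)).1 ∧
        ∃ j < k, (e (σ k)).1.erase x ⊆ (e (σ j)).1 := by
      intro i hi
      by_contra hcon
      push Not at hcon
      have heq : C (e (σ i)) = C (e (σ k)) := by
        refine hshell _ _ (hC _) (hC _) (hsort hi.le) fun r z hr hrn hz hlt => ?_
        by_contra hne
        obtain ⟨j, hj⟩ := hsurj _ hz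
        have hjk : j < k := by
          by_contra hjk
          have := hsort (not_lt.1 hjk)
          simp only [hj] at this
          exact this.not_gt hlt
        refine hcon (C (e (σ k)) r) ?_ ?_ j hjk ?_
        · rw [← hCs]
          exact mem_chainFace.2 ⟨r, hrn.le, rfl⟩
        · intro hmem
          rw [← hCs] at hmem
          obtain ⟨l, hl, he⟩ := mem_chainFace.1 hmem
          have h1 := (hC (e (σ i))).rank_add hρ hl
          have h2 := (hC (e (σ k))).rank_add hρ hrn.le
          rw [he] at h1
          obtain rfl : l = r := by omega
          exact hne he
        · intro x hx
          rw [Finset.mem_erase, ← hCs] at hx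
          obtain ⟨hxr, hx⟩ := hx
          obtain ⟨l, hl, rfl⟩ := mem_chainFace.1 hx
          rw [← hCs, hj]
          refine mem_chainFace.2 ⟨l, hl, Function.update_of_ne ?_ _ _⟩
          rintro rfl
          exact hxr rfl
      have : e (σ i) = e (σ k) := Subtype.ext (by rw [← hCs, ← hCs, heq])
      exact hi.ne (σ.injective (e.injective this))
    have hcov : ∀ x ∈ (e (σ k)).1, (e (σ k)).1.erase x ⋖ (e (σ k)).1 := by
      intro x hx
      have := Finset.covBy_cons (Finset.notMem_erase x (e (σ k)).1)
      rwa [Finset.cons_eq_insert, Finset.insert_erase hx] at this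
    refine ⟨{G | G ⋖ (e (σ k)).1 ∧ ∃ i < k, G ⊆ (e (σ i)).1}, ?_, fun G hG => hG.1, fun s => ?_⟩
    · obtain ⟨x, hx, -, hj⟩ := hcore ⟨0, by omega⟩ hk
      exact ⟨_, hcov x hx, hj⟩
    · constructor
      · rintro ⟨hsk, i, hi, hsi⟩
        obtain ⟨x, hx, hxi, hj⟩ := hcore i hi
        refine ⟨_, ⟨hcov x hx, hj⟩, fun y hy => Finset.mem_erase.2 ⟨?_, hsk hy⟩⟩
        rintro rfl
        exact hxi (hsi hy)
      · rintro ⟨G, ⟨hG, i, hi, hGi⟩, hsG⟩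
        exact ⟨hsG.trans hG.le, i, hi, hsG.trans hGi⟩

end Criterion

/-! ### Pairs crossing an upper set -/

/-- The pairs `lo ≤ hi` whose upper entry lies in `Y` and whose lower entry does not. They are
ordered by inclusion of the intervals `[lo, hi]`. -/
@[ext]
structure Crossing {P : Type*} [PartialOrder P] (Y : Set P) where
  lo : P
  hi : P
  lo_notMem : lo ∉ Y
  hi_mem : hi ∈ Y
  lo_le_hi : lo ≤ hi

namespace Crossing

variable {P : Type*} [PartialOrder P] {Y : Set P}

instance : PartialOrder (Crossing Y) where
  le p q := q.lo ≤ p.lo ∧ p.hi ≤ q.hi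
  le_refl _ := ⟨le_rfl, le_rfl⟩
  le_trans _ _ _ h h' := ⟨h'.1.trans h.1, h.2.trans h'.2⟩
  le_antisymm _ _ h h' := Crossing.ext (le_antisymm h'.1 h.1) (le_antisymm h.2 h'.2)

theorem le_def {p q : Crossing Y} : p ≤ q ↔ q.lo ≤ p.lo ∧ p.hi ≤ q.hi := Iff.rfl

theorem lo_lt_hi (p : Crossing Y) : p.lo < p.hi :=
  lt_of_le_of_ne p.lo_le_hi fun h => p.lo_notMem (h ▸ p.hi_mem)

instance [Finite P] : Finite (Crossing Y) :=
  Finite.of_injective (fun p : Crossing Y => (p.lo, p.hi)) fun p q h => by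
    simp only [Prod.mk.injEq] at h
    exact Crossing.ext h.1 h.2

/-- The rank of a crossing pair with an adjoined bottom element. -/
def rank (ℓ : P → ℕ) : WithBot (Crossing Y) → ℕ
  | ⊥ => 0
  | (p : Crossing Y) => ℓ p.hi - ℓ p.lo

@[simp] theorem rank_bot (ℓ : P → ℕ) : rank ℓ (⊥ : WithBot (Crossing Y)) = 0 := rfl

@[simp] theorem rank_coe (ℓ : P → ℕ) (p : Crossing Y) :
    rank ℓ (p : WithBot (Crossing Y)) = ℓ p.hi - ℓ p.lo := rfl

variable {ℓ : P → ℕ}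

theorem rank_strictMono (hℓ : StrictMono ℓ) :
    StrictMono (rank ℓ : WithBot (Crossing Y) → ℕ) := by
  intro x y hxy
  induction y with
  | bot => exact absurd hxy not_lt_bot
  | coe q =>
    have hq := hℓ q.lo_lt_hi
    induction x with
    | bot => rw [rank_bot, rank_coe]; omega
    | coe p =>
      have hp := hℓ p.lo_lt_hi
      have hlt := WithBot.coe_lt_coe.1 hxy
      obtain ⟨h1, h2⟩ := le_def.1 hlt.le
      have h3 := hℓ.monotone h1
      have h4 := hℓ.monotone h2
      rw [rank_coe, rank_coe]
      rcases h1.eq_or_lt with h1 | h1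
      · rcases h2.eq_or_lt with h2 | h2
        · exact absurd (Crossing.ext h1.symm h2) hlt.ne
        · have := hℓ h2
          omega
      · have := hℓ h1
        omega

theorem covBy_of_rank (hℓ : StrictMono ℓ) {x y : WithBot (Crossing Y)} (hxy : x < y)
    (h : rank ℓ y = rank ℓ x + 1) : x ⋖ y := by
  refine ⟨hxy, fun z h1 h2 => ?_⟩
  have h1 := rank_strictMono hℓ h1
  have h2 := rank_strictMono hℓ h2
  omega

/-- A cover either moves the upper entry down one step, or the lower entry up one step. -/
theorem covBy_cases [Finite P] (hY : IsUpperSet Y) {p q : Crossing Y} (h : p ⋖ q) :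
    (p.lo = q.lo ∧ p.hi ⋖ q.hi) ∨ (q.lo ⋖ p.lo ∧ p.hi = q.hi) := by
  obtain ⟨h1, h2⟩ := le_def.1 h.1.le
  rcases h2.eq_or_lt with h2 | h2
  · right
    refine ⟨⟨lt_of_le_of_ne h1 fun h1 => h.1.ne (Crossing.ext h1.symm h2), fun z hz hz' => ?_⟩, h2⟩
    refine h.2 (c := ⟨z, q.hi, fun hzY => p.lo_notMem (hY hz'.le hzY), q.hi_mem,
      hz'.le.trans (p.lo_le_hi.trans h2.le)⟩) ?_ ?_
    · exact lt_of_le_of_ne ⟨hz'.le, h2.le⟩ fun he => hz'.ne (congrArg lo he).symm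
    · exact lt_of_le_of_ne ⟨hz.le, le_rfl⟩ fun he => hz.ne (congrArg lo he).symm
  · left
    obtain ⟨z, hz, hz'⟩ := exists_le_covBy_of_lt h2
    obtain ⟨t, hlo, rfl⟩ : ∃ t : Crossing Y, t.lo = q.lo ∧ t.hi = z :=
      ⟨⟨q.lo, z, q.lo_notMem, hY hz p.hi_mem, h1.trans (p.lo_le_hi.trans hz)⟩, rfl, rfl⟩
    have hlt : t < q := lt_of_le_of_ne ⟨hlo.ge, hz'.1.le⟩ fun he => hz'.1.ne (congrArg hi he)
    rcases (show p ≤ t from ⟨hlo.trans_le h1, hz⟩).eq_or_lt with he | hlt'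
    · rw [he]
      exact ⟨hlo, hz'⟩
    · exact absurd hlt (h.2 hlt')

theorem covBy_of_bot_covBy [Finite P] {p : Crossing Y} (h : (⊥ : WithBot (Crossing Y)) ⋖ p) :
    p.lo ⋖ p.hi := by
  obtain ⟨z, hz, hz'⟩ := exists_le_covBy_of_lt p.lo_lt_hi
  rcases hz.eq_or_lt with he | hlt
  · rwa [he]
  · exfalso
    by_cases hzY : z ∈ Y
    · refine h.2 (c := ((⟨p.lo, z, p.lo_notMem, hzY, hz⟩ : Crossing Y) : WithBot (Crossing Y)))
        (WithBot.bot_lt_coe _) (WithBot.coe_lt_coe.2 ?_)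
      exact lt_of_le_of_ne ⟨le_rfl, hz'.1.le⟩ fun he => hz'.1.ne (congrArg hi he)
    · refine h.2 (c := ((⟨z, p.hi, hzY, p.hi_mem, hz'.1.le⟩ : Crossing Y) : WithBot (Crossing Y)))
        (WithBot.bot_lt_coe _) (WithBot.coe_lt_coe.2 ?_)
      exact lt_of_le_of_ne ⟨hz, le_rfl⟩ fun he => hlt.ne (congrArg lo he).symm

theorem rank_covBy [Finite P] (hY : IsUpperSet Y) (hℓ : StrictMono ℓ)
    (hcov : ∀ x y : P, x ⋖ y → ℓ y = ℓ x + 1) {x y : WithBot (Crossing Y)} (h : x ⋖ y) :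
    rank ℓ y = rank ℓ x + 1 := by
  induction y with
  | bot => exact absurd h.1 not_lt_bot
  | coe q =>
    induction x with
    | bot =>
      have := hcov _ _ (covBy_of_bot_covBy h)
      rw [rank_coe, rank_bot]
      omega
    | coe p =>
      have hp := hℓ p.lo_lt_hi
      rw [rank_coe, rank_coe]
      rcases covBy_cases hY (WithBot.coe_covBy_coe.1 h) with ⟨h1, h2⟩ | ⟨h1, h2⟩
      · have := hcov _ _ h2
        rw [h1] at hp ⊢
        omega
      · have := hcov _ _ h1
        rw [h2] at hp ⊢
        omega

end Crossing

/-! ### Chains of crossing pairs as lattice paths -/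

/-- A lattice path `e` of `n - 1` steps, `e r` being the number of horizontal steps among the first
`r` ones, which ends after `k` horizontal steps. -/
structure IsLatticePath (n k : ℕ) (e : ℕ → ℕ) : Prop where
  zero : e 0 = 0
  step : ∀ r, r + 1 < n → e (r + 1) = e r ∨ e (r + 1) = e r + 1
  last : e (n - 1) = k

namespace IsLatticePath

variable {n k : ℕ} {e : ℕ → ℕ}

theorem mono (h : IsLatticePath n k e) {i j : ℕ} (hij : i ≤ j) (hj : j < n) : e i ≤ e j := by
  induction j, hij using Nat.le_induction with
  | base => exact le_rfl
  | succ j hij ih =>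
    have := ih (by omega)
    rcases h.step j hj with h | h <;> omega

theorem le_add (h : IsLatticePath n k e) {i j : ℕ} (hij : i ≤ j) (hj : j < n) :
    e j + i ≤ e i + j := by
  induction j, hij using Nat.le_induction with
  | base => exact le_rfl
  | succ j hij ih =>
    have := ih (by omega)
    rcases h.step j hj with h | h <;> omega

theorem le_self (h : IsLatticePath n k e) {r : ℕ} (hr : r < n) : e r ≤ r := by
  have := h.le_add (Nat.zero_le r) hr
  have := h.zero
  omega

theorem le_last (h : IsLatticePath n k e) {r : ℕ} (hr : r < n) : e r ≤ k := by
  have := h.mono (i := r) (j := n - 1) (by omega) (by omega)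
  have := h.last
  omega

theorem last_lt (h : IsLatticePath n k e) {r : ℕ} (hr : r < n) : k < n - r + e r := by
  have := h.le_add (i := r) (j := n - 1) (by omega) (by omega)
  have := h.last
  omega

/-- Each value below the last one is left by a horizontal step. -/
theorem exists_horizontal (h : IsLatticePath n k e) {i : ℕ} (hi : i < k) :
    ∃ r, r + 1 < n ∧ e r = i ∧ e (r + 1) = i + 1 := by
  have hex : ∃ r, i + 1 ≤ e r := ⟨n - 1, by rw [h.last]; omega⟩
  have hfind : Nat.find hex ≤ n - 1 := Nat.find_min' hex (by rw [h.last]; omega)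
  have hspec := Nat.find_spec hex
  have hpos : Nat.find hex ≠ 0 := by
    intro h0
    rw [h0, h.zero] at hspec
    omega
  obtain ⟨r, hr⟩ := Nat.exists_eq_succ_of_ne_zero hpos
  have hmin := Nat.find_min hex (m := r) (by omega)
  rw [hr, Nat.succ_eq_add_one] at hspec hfind
  refine ⟨r, by omega, ?_⟩
  rcases h.step r (by omega) with h | h <;> omega

/-- The path with horizontal and vertical steps interchanged. -/
theorem reflect (h : IsLatticePath n k e) : IsLatticePath n (n - 1 - k) fun r => r - e r := by
  refine ⟨by simp, fun r hr => ?_, ?_⟩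
  · have h1 := h.le_self (r := r) (by omega)
    rcases h.step r hr with h2 | h2
    · right; omega
    · left; omega
  · have := h.last
    omega

/-- Each value of `r - e r` below the last one is left by a vertical step. -/
theorem exists_vertical (h : IsLatticePath n k e) {i : ℕ} (hi : k + 1 < i) (hin : i ≤ n) :
    ∃ r, r + 1 < n ∧ n - r + e r = i ∧ e (r + 1) = e r := by
  obtain ⟨r, hr, h1, h2⟩ := h.reflect.exists_horizontal (i := n - i) (by omega)
  have h3 := h.le_self (r := r) (by omega)
  refine ⟨r, hr, by omega, ?_⟩
  rcases h.step r hr with h4 | h4 <;> omega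

theorem update (h : IsLatticePath n k e) {r v : ℕ} (hr : 0 < r) (hrn : r + 1 < n)
    (h1 : v = e (r - 1) ∨ v = e (r - 1) + 1) (h2 : e (r + 1) = v ∨ e (r + 1) = v + 1) :
    IsLatticePath n k (Function.update e r v) where
  zero := by rw [Function.update_of_ne hr.ne, h.zero]
  step j hj := by
    by_cases hjr : j = r
    · subst hjr
      rwa [Function.update_of_ne (by omega), Function.update_self]
    · by_cases hjr' : j + 1 = r
      · subst hjr'
        rw [Function.update_self, Function.update_of_ne (by omega)]
        exact h1
      · rw [Function.update_of_ne hjr', Function.update_of_ne hjr]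
        exact h.step j hj
  last := by rw [Function.update_of_ne (by omega), h.last]

theorem update_last (h : IsLatticePath n k e) (hn : 1 < n) {v : ℕ}
    (h1 : v = e (n - 2) ∨ v = e (n - 2) + 1) :
    IsLatticePath n v (Function.update e (n - 1) v) where
  zero := by rw [Function.update_of_ne (by omega), h.zero]
  step j hj := by
    by_cases hjr' : j + 1 = n - 1
    · rw [hjr', Function.update_self, Function.update_of_ne (by omega),
        show j = n - 2 by omega]
      exact h1
    · rw [Function.update_of_ne hjr', Function.update_of_ne (by omega)]
      exact h.step j hj
  last := Function.update_self _ _ _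

/-- A path that is somewhere ahead of another one with the same end has a horizontal step followed
by a vertical one at a place where it is ahead. -/
theorem exists_corner {e' : ℕ → ℕ} (h : IsLatticePath n k e) (h' : IsLatticePath n k e') {r : ℕ}
    (hr : r < n) (hlt : e' r < e r) :
    ∃ s, 0 < s ∧ s + 1 < n ∧ e s = e (s - 1) + 1 ∧ e (s + 1) = e s ∧ e' s < e s := by
  -- `a` is the first place where `e` is ahead, and `b` the end of the run of horizontal steps.
  have hexa : ∃ a, e' a < e a := ⟨r, hlt⟩
  have ha := Nat.find_spec hexa
  have hamin : ∀ j < Nat.find hexa, e j ≤ e' j := fun j hj => not_lt.1 (Nat.find_min hexa hj)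
  have har : Nat.find hexa ≤ r := Nat.find_min' hexa hlt
  generalize Nat.find hexa = a at *
  have ha0 : a ≠ 0 := by
    rintro rfl
    rw [h.zero, h'.zero] at ha
    omega
  have han : a ≠ n - 1 := by
    rintro rfl
    rw [h.last, h'.last] at ha
    omega
  have hstepa : e a = e (a - 1) + 1 := by
    have h1 := hamin (a - 1) (by omega)
    have h2 := h.step (a - 1) (by omega)
    have h3 := h'.step (a - 1) (by omega)
    rw [Nat.sub_add_cancel (by omega)] at h2 h3
    omega
  have hexb : ∃ d, n ≤ a + d + 1 ∨ e (a + d + 1) = e (a + d) := ⟨n, Or.inl (by omega)⟩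
  have hb := Nat.find_spec hexb
  have hbmin : ∀ j < Nat.find hexb, a + j + 1 < n ∧ e (a + j + 1) ≠ e (a + j) := fun j hj => by
    have := Nat.find_min hexb hj
    push Not at this
    exact this
  generalize Nat.find hexb = d at *
  have hrun : ∀ j ≤ d, e (a + j) = e a + j ∧ a + j < n := by
    intro j
    induction j with
    | zero => exact fun _ => ⟨rfl, by omega⟩
    | succ j ih =>
      intro hj
      have h1 := ih (by omega)
      have h2 := hbmin j (by omega)
      have h3 := h.step (a + j) h2.1
      rw [← add_assoc]
      omega
  have hd := hrun d le_rfl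
  have hahead : e' (a + d) < e (a + d) := by
    have := h'.le_add (i := a) (j := a + d) (by omega) hd.2
    omega
  have hdn : a + d ≠ n - 1 := by
    intro he
    rw [he, h.last, h'.last] at hahead
    omega
  refine ⟨a + d, by omega, by omega, ?_, hb.resolve_left (by omega), hahead⟩
  rcases Nat.eq_zero_or_pos d with rfl | hd0
  · simpa using hstepa
  · have := (hrun (d - 1) (by omega)).1
    rw [show a + d - 1 = a + (d - 1) by omega]
    omega

/-- The reflected form of `exists_corner`: a path that is somewhere behind another one has a
vertical step followed by a horizontal one at a place where it is behind. -/
theorem exists_corner' {e' : ℕ → ℕ} (h : IsLatticePath n k e) (h' : IsLatticePath n k e') {r : ℕ}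
    (hr : r < n) (hlt : e r < e' r) :
    ∃ s, 0 < s ∧ s + 1 < n ∧ e s = e (s - 1) ∧ e (s + 1) = e s + 1 ∧ e s < e' s := by
  have h1 := h'.le_self hr
  obtain ⟨s, hs, hsn, h2, h3, h4⟩ := h.reflect.exists_corner h'.reflect hr (by omega)
  have h5 := h.le_self (r := s - 1) (by omega)
  have h6 := h.le_self (r := s) (by omega)
  have h7 := h.le_self (r := s + 1) (by omega)
  have h8 := h.step s (by omega)
  have h9 := h.step (s - 1) (by omega)
  rw [Nat.sub_add_cancel hs] at h9
  exact ⟨s, hs, hsn, by omega, by omega, by omega⟩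

end IsLatticePath

/-! ### Shelling the poset of crossing pairs -/

open Classical in
/-- The chain of crossing pairs encoded by a maximal chain `m` and a lattice path `e`: its `r`-th
entry is the pair `(m (n - r + e r), m (e r))` for `r < n` and `⊥` afterwards. The value is also `⊥`
if the pair does not cross `Y`, which does not occur for the paths in `IsCrossingPath`. -/
noncomputable def crossingChain {P : Type*} [PartialOrder P] (Y : Set P) (n : ℕ) (m : ℕ → P)
    (e : ℕ → ℕ) (r : ℕ) : WithBot (Crossing Y) :=
  if h : r < n ∧ m (n - r + e r) ∉ Y ∧ m (e r) ∈ Y ∧ m (n - r + e r) ≤ m (e r) then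
    ((⟨_, _, h.2.1, h.2.2.1, h.2.2.2⟩ : Crossing Y) : WithBot (Crossing Y))
  else ⊥

theorem crossingChain_of_le {P : Type*} [PartialOrder P] {Y : Set P} {n : ℕ} {m : ℕ → P}
    {e : ℕ → ℕ} {r : ℕ} (hr : n ≤ r) : crossingChain Y n m e r = ⊥ :=
  dif_neg fun h => by omega

section CrossingShelling

variable {P : Type*} [PartialOrder P] [BoundedOrder P] {Y : Set P} {ℓ : P → ℕ} {n k k' : ℕ}
  {m m' : ℕ → P} {e e' : ℕ → ℕ}

/-- A maximal chain `m` of `P` that leaves `Y` between `m k` and `m (k + 1)`, together with a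
lattice path `e` that interleaves the two parts of `m`. It encodes the chain of crossing pairs
`(m (n - r + e r), m (e r))` for `r < n`: a horizontal step moves the upper entry down along `m`, a
vertical step moves the lower entry up along `m`. -/
structure IsCrossingPath (Y : Set P) (n : ℕ) (m : ℕ → P) (e : ℕ → ℕ) (k : ℕ) : Prop where
  chain : IsDescChain (· ⋖ ·) n ⊤ ⊥ m
  mem : m k ∈ Y
  notMem : m (k + 1) ∉ Y
  lt : k < n
  path : IsLatticePath n k e

namespace IsCrossingPath

theorem mem_iff (hY : IsUpperSet Y) (h : IsCrossingPath Y n m e k) {i : ℕ} : m i ∈ Y ↔ i ≤ k := by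
  constructor
  · intro hi
    by_contra hik
    exact h.notMem (hY (h.chain.antitone (by omega)) hi)
  · intro hi
    exact hY (h.chain.antitone hi) h.mem

theorem exists_eq (hY : IsUpperSet Y) (h : IsCrossingPath Y n m e k) {r : ℕ} (hr : r < n) :
    ∃ p : Crossing Y, crossingChain Y n m e r = p ∧ p.lo = m (n - r + e r) ∧ p.hi = m (e r) := by
  have h1 := h.path.le_last hr
  have h2 := h.path.last_lt hr
  have hc : r < n ∧ m (n - r + e r) ∉ Y ∧ m (e r) ∈ Y ∧ m (n - r + e r) ≤ m (e r) :=
    ⟨hr, by rw [h.mem_iff hY]; omega, by rwa [h.mem_iff hY], h.chain.antitone (by omega)⟩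
  exact ⟨_, dif_pos hc, rfl, rfl⟩

theorem congr_entries (hY : IsUpperSet Y) (hcov : ∀ x y : P, x ⋖ y → ℓ y = ℓ x + 1)
    (h : IsCrossingPath Y n m e k) (h' : IsCrossingPath Y n m' e' k') {r : ℕ} (hr : r < n)
    (he : crossingChain Y n m' e' r = crossingChain Y n m e r) :
    e' r = e r ∧ m' (e r) = m (e r) ∧ m' (n - r + e r) = m (n - r + e r) := by
  obtain ⟨p, hp, hp1, hp2⟩ := h.exists_eq hY hr
  obtain ⟨p', hp', hp1', hp2'⟩ := h'.exists_eq hY hr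
  rw [hp, hp', WithBot.coe_inj] at he
  subst he
  have h1 := h.chain.rank_add hcov (h.path.le_last hr |>.trans h.lt.le)
  have h2 := h'.chain.rank_add hcov (h'.path.le_last hr |>.trans h'.lt.le)
  rw [← hp2] at h1
  rw [← hp2'] at h2
  have h3 : e' r = e r := by omega
  rw [h3] at hp1' hp2'
  exact ⟨h3, hp2'.symm.trans hp2, hp1'.symm.trans hp1⟩

theorem ext_of_crossingChain_eq (hY : IsUpperSet Y) (hcov : ∀ x y : P, x ⋖ y → ℓ y = ℓ x + 1)
    (h : IsCrossingPath Y n m e k) (h' : IsCrossingPath Y n m' e' k')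
    (he : crossingChain Y n m' e' = crossingChain Y n m e) :
    m' = m ∧ k' = k ∧ ∀ r < n, e' r = e r := by
  have hentry := fun r hr => h.congr_entries hY hcov h' (r := r) hr (congrFun he r)
  have hk : k' = k := by
    have := (hentry (n - 1) (by have := h.lt; omega)).1
    rwa [h.path.last, h'.path.last] at this
  refine ⟨?_, hk, fun r hr => (hentry r hr).1⟩
  have hlt := h.lt
  funext i
  rcases lt_trichotomy i k with hi | rfl | hi
  · obtain ⟨r, hr, rfl, -⟩ := h.path.exists_horizontal hi
    exact (hentry r (by omega)).2.1
  · have := (hentry (n - 1) (by omega)).2.1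
    rwa [h.path.last] at this
  · rcases lt_or_ge n i with hin | hin
    · rw [h.chain.last i hin.le, h'.chain.last i hin.le]
    · obtain rfl | hi := (show k + 1 ≤ i from hi).eq_or_lt
      · have := (hentry (n - 1) (by omega)).2.2
        rw [h.path.last] at this
        rwa [show n - (n - 1) + k = k + 1 by omega] at this
      · obtain ⟨r, hr, rfl, -⟩ := h.path.exists_vertical hi hin
        exact (hentry r (by omega)).2.2

theorem isDescChain (hY : IsUpperSet Y) (hℓ : StrictMono ℓ)
    (hcov : ∀ x y : P, x ⋖ y → ℓ y = ℓ x + 1) {t : Crossing Y} (ht : t.lo = ⊥ ∧ t.hi = ⊤)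
    (h : IsCrossingPath Y n m e k) :
    IsDescChain (· ⋖ ·) n (t : WithBot (Crossing Y)) ⊥ (crossingChain Y n m e) where
  zero := by
    obtain ⟨p, hp, hp1, hp2⟩ := h.exists_eq hY (r := 0) (by have := h.lt; omega)
    rw [hp, WithBot.coe_inj]
    rw [h.path.zero] at hp1 hp2
    exact Crossing.ext (by rw [hp1, ht.1, h.chain.last _ (by omega)])
      (by rw [hp2, ht.2, h.chain.zero])
  rel r hr := by
    obtain ⟨p, hp, hp1, hp2⟩ := h.exists_eq hY hr
    rcases Nat.lt_or_ge (r + 1) n with hr' | hr'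
    · obtain ⟨q, hq, hq1, hq2⟩ := h.exists_eq hY hr'
      have hk1 := h.path.le_last hr
      have hk2 := h.path.le_last hr'
      have hk3 := h.path.last_lt hr'
      have hk := h.lt
      have hle := h.path.le_self hr
      have r1 := hℓ q.lo_lt_hi
      have r2 := hℓ p.lo_lt_hi
      rw [hp, hq]
      refine Crossing.covBy_of_rank hℓ (WithBot.coe_lt_coe.2 ?_) ?_
      · refine lt_of_le_of_ne ⟨?_, ?_⟩ ?_
        · rw [hp1, hq1]
          refine h.chain.antitone ?_
          rcases h.path.step r hr' with h | h <;> omega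
        · rw [hp2, hq2]
          exact h.chain.antitone (h.path.mono (by omega) hr')
        · rintro rfl
          have s1 := h.chain.rank_add hcov (i := e r) (by omega)
          have s2 := h.chain.rank_add hcov (i := e (r + 1)) (by omega)
          have s3 := h.chain.rank_add hcov (i := n - r + e r) (by omega)
          have s4 := h.chain.rank_add hcov (i := n - (r + 1) + e (r + 1)) (by
            rcases h.path.step r hr' with h | h <;> omega)
          rw [← hp2] at s1
          rw [← hq2] at s2
          rw [← hp1] at s3
          rw [← hq1] at s4
          omega
      · have s1 := h.chain.rank_add hcov (i := e r) (by omega)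
        have s2 := h.chain.rank_add hcov (i := e (r + 1)) (by omega)
        have s3 := h.chain.rank_add hcov (i := n - r + e r) (by omega)
        have s4 := h.chain.rank_add hcov (i := n - (r + 1) + e (r + 1)) (by
          rcases h.path.step r hr' with h | h <;> omega)
        rw [Crossing.rank_coe, Crossing.rank_coe, hp1, hp2, hq1, hq2]
        rw [hq1, hq2] at r1
        rw [hp1, hp2] at r2
        omega
    · obtain rfl : r = n - 1 := by omega
      rw [crossingChain_of_le hr', hp]
      refine Crossing.covBy_of_rank hℓ (WithBot.bot_lt_coe _) ?_
      have hk := h.lt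
      have s1 := h.chain.rank_add hcov (i := k) (by omega)
      have s2 := h.chain.rank_add hcov (i := k + 1) (by omega)
      rw [h.path.last] at hp1 hp2
      rw [Crossing.rank_coe, Crossing.rank_bot, hp1, hp2,
        show n - (n - 1) + k = k + 1 by omega]
      omega
  last i hi := crossingChain_of_le hi

end IsCrossingPath

/-- Every maximal chain of crossing pairs is encoded by a maximal chain of `P` and a lattice
path. -/
theorem exists_isCrossingPath [Finite P] (hY : IsUpperSet Y) (hℓ : StrictMono ℓ)
    (hcov : ∀ x y : P, x ⋖ y → ℓ y = ℓ x + 1) (hn : ℓ ⊤ = ℓ ⊥ + n) {t : Crossing Y}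
    (ht : t.lo = ⊥ ∧ t.hi = ⊤) {c : ℕ → WithBot (Crossing Y)}
    (hc : IsDescChain (· ⋖ ·) n (t : WithBot (Crossing Y)) ⊥ c) :
    ∃ m e k, IsCrossingPath Y n m e k ∧ c = crossingChain Y n m e := by
  have hrank : ∀ r ≤ n, Crossing.rank ℓ (c r) + r = n := by
    intro r hr
    have := hc.rank_add (fun x y h => Crossing.rank_covBy hY hℓ hcov h) hr
    rw [this, Crossing.rank_coe, ht.1, ht.2]
    omega
  have hn0 : 0 < n := by
    have := hℓ t.lo_lt_hi
    rw [ht.1, ht.2] at this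
    omega
  have hex : ∀ r, ∃ p : Crossing Y, r < n → c r = p := by
    intro r
    by_cases hr : r < n
    · have := hrank r hr.le
      cases hcr : c r with
      | bot => rw [hcr, Crossing.rank_bot] at this; omega
      | coe p => exact ⟨p, fun _ => rfl⟩
    · exact ⟨t, fun h => absurd h hr⟩
  choose p hp using hex
  have hp0 : p 0 = t := by
    have h1 := hp 0 hn0
    rw [hc.zero, WithBot.coe_inj] at h1
    exact h1.symm
  have hprank : ∀ r < n, ℓ (p r).hi + r = ℓ (p r).lo + n := by
    intro r hr
    have h1 := hrank r hr.le
    have h2 := hℓ (p r).lo_lt_hi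
    rw [hp r hr, Crossing.rank_coe] at h1
    omega
  have hstep : ∀ r, r + 1 < n → ((p (r + 1)).lo = (p r).lo ∧ (p (r + 1)).hi ⋖ (p r).hi) ∨
      ((p r).lo ⋖ (p (r + 1)).lo ∧ (p (r + 1)).hi = (p r).hi) := by
    intro r hr
    have h1 := hc.rel r (by omega)
    rw [hp r (by omega), hp (r + 1) hr] at h1
    exact Crossing.covBy_cases hY (WithBot.coe_covBy_coe.1 h1)
  obtain ⟨e, he⟩ : ∃ e : ℕ → ℕ, ∀ r, ℓ (p r).hi + e r = ℓ ⊤ :=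
    ⟨fun r => ℓ ⊤ - ℓ (p r).hi, fun r =>
      Nat.add_sub_cancel' (hℓ.monotone le_top)⟩
  have hpath : IsLatticePath n (e (n - 1)) e := by
    refine ⟨?_, fun r hr => ?_, rfl⟩
    · have := he 0
      rw [hp0, ht.2] at this
      omega
    · have h1 := he r
      have h2 := he (r + 1)
      rcases hstep r hr with ⟨-, h⟩ | ⟨-, h⟩
      · have := hcov _ _ h
        right; omega
      · rw [h] at h2
        left; omega
  have hmono : ∀ {r s}, r ≤ s → s < n → p s ≤ p r := by
    intro r s hrs hs
    have h1 := hc.antitone hrs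
    rwa [hp r (by omega), hp s hs, WithBot.coe_le_coe] at h1
  have heq : ∀ {x y : P}, x ≤ y → ℓ x = ℓ y → x = y := fun {x y} hxy hl => by
    by_contra hne
    exact (hℓ (lt_of_le_of_ne hxy hne)).ne hl
  have hhi : ∀ {r s}, r < n → s < n → e r = e s → (p r).hi = (p s).hi := by
    intro r s hr hs hrs
    have h1 := he r
    have h2 := he s
    rcases le_total r s with h | h
    · exact (heq (hmono h hs).2 (by omega)).symm
    · exact heq (hmono h hr).2 (by omega)
  have hlo : ∀ {r s}, r < n → s < n → n - r + e r = n - s + e s → (p r).lo = (p s).lo := by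
    intro r s hr hs hrs
    have h1 := he r
    have h2 := he s
    have h3 := hprank r hr
    have h4 := hprank s hs
    rcases le_total r s with h | h
    · exact heq (hmono h hs).1 (by omega)
    · exact (heq (hmono h hr).1 (by omega)).symm
  have hm : ∀ i, ∃ x : P, (∀ r < n, e r = i → (p r).hi = x) ∧
      (∀ r < n, n - r + e r = i → (p r).lo = x) ∧ (n ≤ i → x = ⊥) := by
    intro i
    have hkn : e (n - 1) ≤ n - 1 := hpath.le_self (by omega)
    by_cases hi : n ≤ i
    · refine ⟨⊥, fun r hr hri => ?_, fun r hr hri => ?_, fun _ => rfl⟩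
      · have := hpath.le_self hr
        omega
      · have h1 := hpath.le_self hr
        have h2 := he r
        have h3 := hprank r hr
        exact (heq bot_le (by omega)).symm
    · by_cases hik : i ≤ e (n - 1)
      · obtain ⟨s, hs, hsi⟩ : ∃ s < n, e s = i := by
          rcases hik.eq_or_lt with h | h
          · exact ⟨n - 1, by omega, h.symm⟩
          · obtain ⟨s, hs, hsi, -⟩ := hpath.exists_horizontal h
            exact ⟨s, by omega, hsi⟩
        refine ⟨(p s).hi, fun r hr hri => hhi hr hs (by omega),
          fun r hr hri => ?_, fun h => by omega⟩
        have := hpath.last_lt hr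
        omega
      · obtain ⟨s, hs, hsi⟩ : ∃ s < n, n - s + e s = i := by
          rcases (Nat.succ_le_of_lt (not_le.1 hik)).eq_or_lt with h | h
          · exact ⟨n - 1, by omega, by omega⟩
          · obtain ⟨s, hs, hsi, -⟩ := hpath.exists_vertical h (by omega)
            exact ⟨s, by omega, hsi⟩
        refine ⟨(p s).lo, fun r hr hri => ?_,
          fun r hr hri => hlo hr hs (by omega), fun h => by omega⟩
        have := hpath.le_last hr
        omega
  choose m hm1 hm2 hm3 using hm
  have hkn : e (n - 1) ≤ n - 1 := hpath.le_self (by omega)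
  have hmk : m (e (n - 1)) = (p (n - 1)).hi := (hm1 _ (n - 1) (by omega) rfl).symm
  have hmk' : m (e (n - 1) + 1) = (p (n - 1)).lo :=
    (hm2 _ (n - 1) (by omega) (by omega)).symm
  have hcross : IsCrossingPath Y n m e (e (n - 1)) := by
    refine ⟨⟨?_, fun i hi => ?_, hm3⟩, ?_, ?_, by omega, hpath⟩
    · rw [← hm1 0 0 hn0 hpath.zero, hp0, ht.2]
    · rcases lt_trichotomy i (e (n - 1)) with hik | rfl | hik
      · obtain ⟨r, hr, h1, h2⟩ := hpath.exists_horizontal hik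
        rw [← hm1 i r (by omega) h1, ← hm1 (i + 1) (r + 1) hr h2]
        rcases hstep r hr with ⟨-, h⟩ | ⟨-, h⟩
        · exact h
        · have h3 := he r
          have h4 := he (r + 1)
          rw [h] at h4
          omega
      · rw [hmk, hmk']
        have h1 := hc.rel (n - 1) (by omega)
        rw [hc.last (n - 1 + 1) (by omega), hp (n - 1) (by omega)] at h1
        exact Crossing.covBy_of_bot_covBy h1
      · obtain ⟨r, hr, h1, h2⟩ := hpath.exists_vertical (i := i + 1) (by omega) hi
        rw [← hm2 (i + 1) r (by omega) h1, ← hm2 i (r + 1) hr (by omega)]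
        rcases hstep r hr with ⟨-, h⟩ | ⟨h, -⟩
        · have h3 := he r
          have h4 := he (r + 1)
          have h5 := hcov _ _ h
          omega
        · exact h
    · rw [hmk]
      exact (p (n - 1)).hi_mem
    · rw [hmk']
      exact (p (n - 1)).lo_notMem
  refine ⟨m, e, _, hcross, ?_⟩
  funext r
  rcases lt_or_ge r n with hr | hr
  · obtain ⟨q, hq, hq1, hq2⟩ := hcross.exists_eq hY hr
    rw [hp r hr, hq, WithBot.coe_inj]
    exact Crossing.ext ((hm2 _ r hr rfl).trans hq1.symm) ((hm1 _ r hr rfl).trans hq2.symm)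
  · rw [hc.last r hr, crossingChain_of_le hr]

end CrossingShelling

section CrossingKey

variable {P : Type*} [PartialOrder P] [BoundedOrder P] {Y : Set P} {ℓ : P → ℕ} {n k k' : ℕ}
  {m m' : ℕ → P} {e e' : ℕ → ℕ} {α : Type*} [LinearOrder α] {key : (ℕ → P) → α}

/-- The `i`-th entry of the maximal chain `m` can be exchanged with a decrease of the key. -/
def IsExchangeable (key : (ℕ → P) → α) (n : ℕ) (m : ℕ → P) (i : ℕ) : Prop :=
  ∃ x, IsDescChain (· ⋖ ·) n ⊤ ⊥ (Function.update m i x) ∧ key (Function.update m i x) < key m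

open Classical in
/-- The weight ranking the lattice paths along a fixed maximal chain `m`: vertical steps come first
if the last entry of `m` in `Y` is exchangeable, and horizontal steps come first otherwise. -/
noncomputable def pathWeight (key : (ℕ → P) → α) (n : ℕ) (m : ℕ → P) (e : ℕ → ℕ) (k : ℕ) : ℤ :=
  if IsExchangeable key n m k then ∑ r ∈ Finset.range n, (e r : ℤ)
  else -∑ r ∈ Finset.range n, (e r : ℤ)

open Classical in
/-- The key of a maximal chain of crossing pairs: the key of the underlying maximal chain of `P`,
then the weight of the lattice path. -/
noncomputable def crossingKey (Y : Set P) (key : (ℕ → P) → α) (n : ℕ)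
    (c : ℕ → WithBot (Crossing Y)) : α ×ₗ ℤ :=
  if h : ∃ d : (ℕ → P) × (ℕ → ℕ) × ℕ,
      IsCrossingPath Y n d.1 d.2.1 d.2.2 ∧ c = crossingChain Y n d.1 d.2.1 then
    toLex (key h.choose.1, pathWeight key n h.choose.1 h.choose.2.1 h.choose.2.2)
  else toLex (key fun _ => ⊥, 0)

namespace IsCrossingPath

theorem crossingKey_eq (hY : IsUpperSet Y) (hcov : ∀ x y : P, x ⋖ y → ℓ y = ℓ x + 1)
    (h : IsCrossingPath Y n m e k) :
    crossingKey Y key n (crossingChain Y n m e) = toLex (key m, pathWeight key n m e k) := by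
  have hex : ∃ d : (ℕ → P) × (ℕ → ℕ) × ℕ, IsCrossingPath Y n d.1 d.2.1 d.2.2 ∧
      crossingChain Y n m e = crossingChain Y n d.1 d.2.1 := ⟨(m, e, k), h, rfl⟩
  rw [crossingKey, dif_pos hex]
  obtain ⟨h1, h2⟩ := hex.choose_spec
  obtain ⟨h3, h4, h5⟩ := h.ext_of_crossingChain_eq hY hcov h1 h2.symm
  have h6 : ∑ r ∈ Finset.range n, (hex.choose.2.1 r : ℤ) = ∑ r ∈ Finset.range n, (e r : ℤ) :=
    Finset.sum_congr rfl fun r hr => by rw [h5 r (Finset.mem_range.1 hr)]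
  rw [pathWeight, pathWeight, h6, h3, h4]

theorem crossingKey_lt (hY : IsUpperSet Y) (hcov : ∀ x y : P, x ⋖ y → ℓ y = ℓ x + 1)
    (h : IsCrossingPath Y n m e k) (h' : IsCrossingPath Y n m' e' k') (hlt : key m' < key m) :
    crossingKey Y key n (crossingChain Y n m' e') <
      crossingKey Y key n (crossingChain Y n m e) := by
  rw [h.crossingKey_eq hY hcov, h'.crossingKey_eq hY hcov, Prod.Lex.toLex_lt_toLex]
  exact Or.inl hlt

theorem crossingKey_lt_of_weight (hY : IsUpperSet Y) (hcov : ∀ x y : P, x ⋖ y → ℓ y = ℓ x + 1)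
    (h : IsCrossingPath Y n m e k) (h' : IsCrossingPath Y n m e' k)
    (hlt : pathWeight key n m e' k < pathWeight key n m e k) :
    crossingKey Y key n (crossingChain Y n m e') < crossingKey Y key n (crossingChain Y n m e) := by
  rw [h.crossingKey_eq hY hcov, h'.crossingKey_eq hY hcov, Prod.Lex.toLex_lt_toLex]
  exact Or.inr ⟨rfl, hlt⟩

/-- Two encoded chains which agree except in position `r` differ by the exchange of one entry. -/
theorem update_eq_crossingChain (hY : IsUpperSet Y) (h : IsCrossingPath Y n m e k)
    (h' : IsCrossingPath Y n m' e' k') {r : ℕ}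
    (hagree : ∀ j < n, j ≠ r → e' j = e j ∧ m' (e j) = m (e j) ∧
      m' (n - j + e j) = m (n - j + e j)) :
    Function.update (crossingChain Y n m e) r (crossingChain Y n m' e' r) =
      crossingChain Y n m' e' := by
  funext j
  by_cases hjr : j = r
  · rw [hjr, Function.update_self]
  rw [Function.update_of_ne hjr]
  rcases lt_or_ge j n with hj | hj
  · obtain ⟨h1, h2, h3⟩ := hagree j hj hjr
    obtain ⟨p, hp, hp1, hp2⟩ := h.exists_eq hY hj
    obtain ⟨q, hq, hq1, hq2⟩ := h'.exists_eq hY hj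
    rw [hp, hq, WithBot.coe_inj]
    rw [h1] at hq1 hq2
    exact Crossing.ext (by rw [hp1, hq1, h3]) (by rw [hp2, hq2, h2])
  · rw [crossingChain_of_le hj, crossingChain_of_le hj]

/-- The path `e` is changed in position `r` only. -/
theorem update_path (h : IsCrossingPath Y n m e k) {r v : ℕ} (hr : 0 < r) (hrn : r + 1 < n)
    (h1 : v = e (r - 1) ∨ v = e (r - 1) + 1) (h2 : e (r + 1) = v ∨ e (r + 1) = v + 1) :
    IsCrossingPath Y n m (Function.update e r v) k :=
  ⟨h.chain, h.mem, h.notMem, h.lt, h.path.update hr hrn h1 h2⟩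

theorem sum_update {r v : ℕ} (hr : r < n) :
    ∑ j ∈ Finset.range n, (Function.update e r v j : ℤ) + e r =
      ∑ j ∈ Finset.range n, (e j : ℤ) + v := by
  rw [← Finset.add_sum_erase _ _ (Finset.mem_range.2 hr),
    ← Finset.add_sum_erase _ (fun j => (e j : ℤ)) (Finset.mem_range.2 hr), Function.update_self,
    Finset.sum_congr rfl fun j hj => by rw [Function.update_of_ne (Finset.ne_of_mem_erase hj)]]
  ring

/-- The positions `r` at which the chain of crossing pairs encoded by `m` and `e` admits an exchange
that decreases the key. -/
def IsExchange (Y : Set P) (key : (ℕ → P) → α) (n : ℕ) (m : ℕ → P) (e : ℕ → ℕ) (r : ℕ) : Prop :=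
  ∃ m' e' k', IsCrossingPath Y n m' e' k' ∧
    (∀ j < n, j ≠ r → e' j = e j ∧ m' (e j) = m (e j) ∧ m' (n - j + e j) = m (n - j + e j)) ∧
    crossingKey Y key n (crossingChain Y n m' e') < crossingKey Y key n (crossingChain Y n m e)

theorem isExchange_corner (hY : IsUpperSet Y) (hcov : ∀ x y : P, x ⋖ y → ℓ y = ℓ x + 1)
    (h : IsCrossingPath Y n m e k) (hk : IsExchangeable key n m k) {r : ℕ} (hr : 0 < r)
    (hrn : r + 1 < n) (h1 : e r = e (r - 1) + 1) (h2 : e (r + 1) = e r) :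
    IsExchange Y key n m e r := by
  have h' := h.update_path (v := e r - 1) hr hrn (by omega) (by omega)
  refine ⟨m, _, k, h', fun j _ hjr => ⟨Function.update_of_ne hjr _ _, rfl, rfl⟩,
    h.crossingKey_lt_of_weight hY hcov h' ?_⟩
  have := sum_update (e := e) (v := e r - 1) (show r < n by omega)
  rw [pathWeight, pathWeight, if_pos hk, if_pos hk]
  omega

theorem isExchange_corner' (hY : IsUpperSet Y) (hcov : ∀ x y : P, x ⋖ y → ℓ y = ℓ x + 1)
    (h : IsCrossingPath Y n m e k) (hk : ¬ IsExchangeable key n m k) {r : ℕ} (hr : 0 < r)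
    (hrn : r + 1 < n) (h1 : e r = e (r - 1)) (h2 : e (r + 1) = e r + 1) :
    IsExchange Y key n m e r := by
  have h' := h.update_path (v := e r + 1) hr hrn (by omega) (by omega)
  refine ⟨m, _, k, h', fun j _ hjr => ⟨Function.update_of_ne hjr _ _, rfl, rfl⟩,
    h.crossingKey_lt_of_weight hY hcov h' ?_⟩
  have := sum_update (e := e) (v := e r + 1) (show r < n by omega)
  rw [pathWeight, pathWeight, if_neg hk, if_neg hk]
  omega

/-- An entry of `m` in `Y`, other than the last one, which occurs only once among the crossing
pairs. -/
theorem isExchange_hi (hY : IsUpperSet Y) (hcov : ∀ x y : P, x ⋖ y → ℓ y = ℓ x + 1)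
    (h : IsCrossingPath Y n m e k) {i : ℕ} (hi : IsExchangeable key n m i) (hik : i < k) {r : ℕ}
    (hr : 0 < r) (hrn : r + 1 < n) (hri : e r = i) (h1 : e r = e (r - 1) + 1)
    (h2 : e (r + 1) = e r + 1) : IsExchange Y key n m e r := by
  obtain ⟨x, hx, hlt⟩ := hi
  have h' : IsCrossingPath Y n (Function.update m i x) e k :=
    ⟨hx, by rw [Function.update_of_ne (by omega)]; exact h.mem,
      by rw [Function.update_of_ne (by omega)]; exact h.notMem, h.lt, h.path⟩
  refine ⟨_, e, k, h', fun j hj hjr => ⟨rfl, Function.update_of_ne ?_ _ _,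
    Function.update_of_ne ?_ _ _⟩, h.crossingKey_lt hY hcov h' hlt⟩
  · rcases lt_or_gt_of_ne hjr with hjr | hjr
    · have := h.path.mono (i := j) (j := r - 1) (by omega) (by omega)
      omega
    · have := h.path.mono (i := r + 1) (j := j) (by omega) hj
      omega
  · have := h.path.last_lt hj
    omega

/-- An entry of `m` outside `Y`, other than the first one, which occurs only once among the crossing
pairs. -/
theorem isExchange_lo (hY : IsUpperSet Y) (hcov : ∀ x y : P, x ⋖ y → ℓ y = ℓ x + 1)
    (h : IsCrossingPath Y n m e k) {i : ℕ} (hi : IsExchangeable key n m i) (hik : k + 1 < i)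
    {r : ℕ} (hr : 0 < r) (hrn : r + 1 < n) (hri : n - r + e r = i) (h1 : e r = e (r - 1))
    (h2 : e (r + 1) = e r) : IsExchange Y key n m e r := by
  obtain ⟨x, hx, hlt⟩ := hi
  have h' : IsCrossingPath Y n (Function.update m i x) e k :=
    ⟨hx, by rw [Function.update_of_ne (by omega)]; exact h.mem,
      by rw [Function.update_of_ne (by omega)]; exact h.notMem, h.lt, h.path⟩
  refine ⟨_, e, k, h', fun j hj hjr => ⟨rfl, Function.update_of_ne ?_ _ _,
    Function.update_of_ne ?_ _ _⟩, h.crossingKey_lt hY hcov h' hlt⟩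
  · have := h.path.le_last hj
    omega
  · rcases lt_or_gt_of_ne hjr with hjr | hjr
    · have := h.path.le_add (i := j) (j := r - 1) (by omega) (by omega)
      omega
    · have := h.path.le_add (i := r + 1) (j := j) (by omega) hj
      omega

/-- The last entry of `m` in `Y`, if it occurs only in the last crossing pair. The new entry may lie
outside `Y`, and then the chain leaves `Y` one step earlier. -/
theorem isExchange_last_hi (hY : IsUpperSet Y) (hcov : ∀ x y : P, x ⋖ y → ℓ y = ℓ x + 1)
    (h : IsCrossingPath Y n m e k) (hk : IsExchangeable key n m k) (hn : 1 < n)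
    (h1 : e (n - 1) = e (n - 2) + 1) : IsExchange Y key n m e (n - 1) := by
  classical
  obtain ⟨x, hx, hlt⟩ := hk
  have hlast := h.path.last
  have hkn := h.lt
  have hne : ∀ j < n, j ≠ n - 1 → e j ≠ k ∧ n - j + e j ≠ k := by
    intro j hj hjn
    have := h.path.mono (i := j) (j := n - 2) (by omega) (by omega)
    have := h.path.last_lt hj
    omega
  by_cases hxY : x ∈ Y
  · have h' : IsCrossingPath Y n (Function.update m k x) e k :=
      ⟨hx, by rwa [Function.update_self],
        by rw [Function.update_of_ne (by omega)]; exact h.notMem, h.lt, h.path⟩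
    exact ⟨_, e, k, h', fun j hj hjr => ⟨rfl, Function.update_of_ne (hne j hj hjr).1 _ _,
      Function.update_of_ne (hne j hj hjr).2 _ _⟩, h.crossingKey_lt hY hcov h' hlt⟩
  · have h' : IsCrossingPath Y n (Function.update m k x) (Function.update e (n - 1) (k - 1))
        (k - 1) := by
      refine ⟨hx, ?_, ?_, by omega, h.path.update_last hn (by omega)⟩
      · rw [Function.update_of_ne (by omega)]
        exact (h.mem_iff hY).2 (by omega)
      · rwa [show k - 1 + 1 = k by omega, Function.update_self]
    exact ⟨_, _, _, h', fun j hj hjr => ⟨Function.update_of_ne hjr _ _,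
      Function.update_of_ne (hne j hj hjr).1 _ _, Function.update_of_ne (hne j hj hjr).2 _ _⟩,
      h.crossingKey_lt hY hcov h' hlt⟩

/-- The first entry of `m` outside `Y`, if it occurs only in the last crossing pair. The new entry
may lie in `Y`, and then the chain leaves `Y` one step later. -/
theorem isExchange_last_lo (hY : IsUpperSet Y) (hcov : ∀ x y : P, x ⋖ y → ℓ y = ℓ x + 1)
    (h : IsCrossingPath Y n m e k) (hk : IsExchangeable key n m (k + 1)) (hkn : k + 1 < n)
    (h1 : e (n - 1) = e (n - 2)) : IsExchange Y key n m e (n - 1) := by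
  classical
  obtain ⟨x, hx, hlt⟩ := hk
  have hlast := h.path.last
  have hne : ∀ j < n, j ≠ n - 1 → e j ≠ k + 1 ∧ n - j + e j ≠ k + 1 := by
    intro j hj hjn
    have := h.path.le_add (i := j) (j := n - 2) (by omega) (by omega)
    have := h.path.le_last hj
    omega
  by_cases hxY : x ∈ Y
  · have h' : IsCrossingPath Y n (Function.update m (k + 1) x)
        (Function.update e (n - 1) (k + 1)) (k + 1) := by
      refine ⟨hx, by rwa [Function.update_self], ?_, hkn,
        h.path.update_last (by omega) (by omega)⟩
      rw [Function.update_of_ne (by omega), h.mem_iff hY]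
      omega
    exact ⟨_, _, _, h', fun j hj hjr => ⟨Function.update_of_ne hjr _ _,
      Function.update_of_ne (hne j hj hjr).1 _ _, Function.update_of_ne (hne j hj hjr).2 _ _⟩,
      h.crossingKey_lt hY hcov h' hlt⟩
  · have h' : IsCrossingPath Y n (Function.update m (k + 1) x) e k :=
      ⟨hx, by rw [Function.update_of_ne (by omega)]; exact h.mem,
        by rwa [Function.update_self], h.lt, h.path⟩
    exact ⟨_, e, k, h', fun j hj hjr => ⟨rfl, Function.update_of_ne (hne j hj hjr).1 _ _,
      Function.update_of_ne (hne j hj hjr).2 _ _⟩, h.crossingKey_lt hY hcov h' hlt⟩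

/-- Each exchangeable entry of the underlying chain `m` occurs in a crossing pair which is itself
exchangeable. The choice of weight in `pathWeight` is what makes this true at the two entries
where `m` leaves `Y`. -/
theorem exists_isExchange (hY : IsUpperSet Y) (hcov : ∀ x y : P, x ⋖ y → ℓ y = ℓ x + 1)
    (h : IsCrossingPath Y n m e k) {i : ℕ} (hi : IsExchangeable key n m i) (hi0 : 0 < i)
    (hin : i < n) :
    ∃ r, 0 < r ∧ r < n ∧ (e r = i ∨ n - r + e r = i) ∧ IsExchange Y key n m e r := by
  have hlast := h.path.last
  have hkn := h.lt
  by_cases hk : IsExchangeable key n m k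
  · rcases Nat.lt_or_ge k i with hik | hik
    · rcases (show k + 1 ≤ i from hik).eq_or_lt with rfl | hik'
      · refine ⟨n - 1, by omega, by omega, Or.inr (by omega), ?_⟩
        have hs := h.path.step (n - 2) (by omega)
        rw [show n - 2 + 1 = n - 1 by omega] at hs
        rcases hs with hs | hs
        · exact h.isExchange_last_lo hY hcov hi hin hs
        · exact h.isExchange_last_hi hY hcov hk (by omega) hs
      · obtain ⟨r, hr, hri, hr2⟩ := h.path.exists_vertical hik' hin.le
        have hr0 : 0 < r := by
          rcases Nat.eq_zero_or_pos r with rfl | hr0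
          · omega
          · exact hr0
        refine ⟨r, hr0, by omega, Or.inr hri, ?_⟩
        have hs := h.path.step (r - 1) (by omega)
        rw [Nat.sub_add_cancel hr0] at hs
        rcases hs with hs | hs
        · exact h.isExchange_lo hY hcov hi hik' hr0 hr hri hs hr2
        · exact h.isExchange_corner hY hcov hk hr0 hr hs hr2
    · obtain ⟨s, hs, hsi, hs2⟩ := h.path.exists_horizontal (i := i - 1) (by omega)
      refine ⟨s + 1, by omega, hs, Or.inl (by omega), ?_⟩
      rcases (show s + 1 + 1 ≤ n from hs).eq_or_lt with he | hs'
      · obtain rfl : s = n - 2 := by omega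
        rw [show n - 2 + 1 = n - 1 by omega] at hs2 ⊢
        exact h.isExchange_last_hi hY hcov hk (by omega) (by omega)
      · rcases h.path.step (s + 1) hs' with h3 | h3
        · exact h.isExchange_corner hY hcov hk (by omega) hs' (by rw [Nat.add_sub_cancel]; omega) h3
        · have := h.path.le_last hs'
          exact h.isExchange_hi hY hcov hi (by omega) (by omega) hs' (by omega)
            (by rw [Nat.add_sub_cancel]; omega) h3
  · have hik : i ≠ k := by
      rintro rfl
      exact hk hi
    rcases Nat.lt_or_ge k i with hik | hik
    · obtain ⟨s, hs, hsi, hs2⟩ : ∃ s, s + 1 < n ∧ n - (s + 1) + e (s + 1) = i ∧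
          e (s + 1) = e s := by
        obtain ⟨s, hs, h1, h2⟩ := h.path.exists_vertical (i := i + 1) (by omega) hin
        exact ⟨s, hs, by omega, h2⟩
      refine ⟨s + 1, by omega, hs, Or.inr hsi, ?_⟩
      rcases (show s + 1 + 1 ≤ n from hs).eq_or_lt with he | hs'
      · obtain rfl : s = n - 2 := by omega
        rw [show n - 2 + 1 = n - 1 by omega] at hs2 hsi ⊢
        obtain rfl : i = k + 1 := by omega
        exact h.isExchange_last_lo hY hcov hi hin hs2
      · rcases h.path.step (s + 1) hs' with h3 | h3
        · have := h.path.last_lt hs'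
          exact h.isExchange_lo hY hcov hi (by omega) (by omega) hs' hsi
            (by rw [Nat.add_sub_cancel]; omega) h3
        · exact h.isExchange_corner' hY hcov hk (by omega) hs' (by rw [Nat.add_sub_cancel]; omega)
            h3
    · obtain ⟨r, hr, hri, hr2⟩ := h.path.exists_horizontal (i := i) (by omega)
      have hr0 : 0 < r := by
        rcases Nat.eq_zero_or_pos r with rfl | hr0
        · have := h.path.zero
          omega
        · exact hr0
      refine ⟨r, hr0, by omega, Or.inl hri, ?_⟩
      have hs := h.path.step (r - 1) (by omega)
      rw [Nat.sub_add_cancel hr0] at hs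
      rcases hs with hs | hs
      · exact h.isExchange_corner' hY hcov hk hr0 hr hs (by omega)
      · exact h.isExchange_hi hY hcov hi (by omega) hr0 hr hri hs (by omega)

/-- Along a fixed maximal chain of `P`, a path is determined by its exchangeable corners among the
paths of at most the same weight. -/
theorem path_eq_of_weight_le (hY : IsUpperSet Y) (hcov : ∀ x y : P, x ⋖ y → ℓ y = ℓ x + 1)
    (h : IsCrossingPath Y n m e k) (h' : IsCrossingPath Y n m e' k)
    (hw : pathWeight key n m e' k ≤ pathWeight key n m e k)
    (hagree : ∀ r, 0 < r → r < n → IsExchange Y key n m e r → e' r = e r) :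
    ∀ r < n, e' r = e r := by
  by_contra hcon
  push Not at hcon
  obtain ⟨r, hr, hne⟩ := hcon
  by_cases hk : IsExchangeable key n m k
  · have hle : ∀ r < n, e r ≤ e' r := by
      intro r hr
      by_contra hlt
      obtain ⟨s, hs0, hsn, h1, h2, h3⟩ := h.path.exists_corner h'.path hr (not_le.1 hlt)
      have := hagree s hs0 (by omega) (h.isExchange_corner hY hcov hk hs0 hsn h1 h2)
      omega
    have : ∑ r ∈ Finset.range n, (e r : ℤ) < ∑ r ∈ Finset.range n, (e' r : ℤ) :=
      Finset.sum_lt_sum (fun j hj => by exact_mod_cast hle j (Finset.mem_range.1 hj))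
        ⟨r, Finset.mem_range.2 hr, by have := hle r hr; omega⟩
    rw [pathWeight, pathWeight, if_pos hk, if_pos hk] at hw
    omega
  · have hle : ∀ r < n, e' r ≤ e r := by
      intro r hr
      by_contra hlt
      obtain ⟨s, hs0, hsn, h1, h2, h3⟩ := h.path.exists_corner' h'.path hr (not_le.1 hlt)
      have := hagree s hs0 (by omega) (h.isExchange_corner' hY hcov hk hs0 hsn h1 h2)
      omega
    have : ∑ r ∈ Finset.range n, (e' r : ℤ) < ∑ r ∈ Finset.range n, (e r : ℤ) :=
      Finset.sum_lt_sum (fun j hj => by exact_mod_cast hle j (Finset.mem_range.1 hj))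
        ⟨r, Finset.mem_range.2 hr, by have := hle r hr; omega⟩
    rw [pathWeight, pathWeight, if_neg hk, if_neg hk] at hw
    omega

end IsCrossingPath

/-- A chain shelling of `P` induces a chain shelling of the crossing pairs of an upper set. -/
theorem isChainShelling_crossingKey [Finite P] (hY : IsUpperSet Y) (hℓ : StrictMono ℓ)
    (hcov : ∀ x y : P, x ⋖ y → ℓ y = ℓ x + 1) (hn : ℓ ⊤ = ℓ ⊥ + n) {t : Crossing Y}
    (ht : t.lo = ⊥ ∧ t.hi = ⊤) (hshell : IsChainShelling (· ⋖ ·) n (⊤ : P) ⊥ key) :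
    IsChainShelling (· ⋖ ·) n (t : WithBot (Crossing Y)) ⊥ (crossingKey Y key n) := by
  intro c c' hc hc' hkey hagree
  obtain ⟨m, e, k, h, rfl⟩ := exists_isCrossingPath hY hℓ hcov hn ht hc
  obtain ⟨m', e', k', h', rfl⟩ := exists_isCrossingPath hY hℓ hcov hn ht hc'
  have hentry : ∀ r, 0 < r → r < n → IsCrossingPath.IsExchange Y key n m e r →
      e' r = e r ∧ m' (e r) = m (e r) ∧ m' (n - r + e r) = m (n - r + e r) := by
    rintro r hr hrn ⟨m₁, e₁, k₁, h₁, hag, hlt⟩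
    have hu := h.update_eq_crossingChain hY h₁ hag
    refine h.congr_entries hY hcov h' hrn (hagree r (crossingChain Y n m₁ e₁ r) hr hrn ?_ ?_)
    · rw [hu]
      exact h₁.isDescChain hY hℓ hcov ht
    · rwa [hu]
  rw [h.crossingKey_eq hY hcov, h'.crossingKey_eq hY hcov, Prod.Lex.toLex_le_toLex] at hkey
  have hm : m' = m := by
    refine hshell m m' h.chain h'.chain ?_ fun i x hi0 hin hx hlt => ?_
    · rcases hkey with hkey | hkey
      · exact hkey.le
      · exact hkey.1.le
    · obtain ⟨r, hr, hrn, hri, hex⟩ := h.exists_isExchange hY hcov ⟨x, hx, hlt⟩ hi0 hin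
      obtain ⟨-, h2, h3⟩ := hentry r hr hrn hex
      rcases hri with rfl | rfl
      · exact h2
      · exact h3
  subst hm
  have hk : k' = k := le_antisymm ((h.mem_iff hY).1 h'.mem) ((h'.mem_iff hY).1 h.mem)
  subst hk
  have hw := (hkey.resolve_left (lt_irrefl _)).2
  have he := h.path_eq_of_weight_le hY hcov h' hw fun r hr hrn hex => (hentry r hr hrn hex).1
  funext r
  rcases lt_or_ge r n with hr | hr
  · obtain ⟨p, hp, hp1, hp2⟩ := h.exists_eq hY hr
    obtain ⟨q, hq, hq1, hq2⟩ := h'.exists_eq hY hr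
    rw [he r hr] at hq1 hq2
    rw [hp, hq, WithBot.coe_inj]
    exact Crossing.ext (hq1.trans hp1.symm) (hq2.trans hp2.symm)
  · rw [crossingChain_of_le hr, crossingChain_of_le hr]

end CrossingKey

/-! ### Adjoining a free generator to a Coxeter system -/

/-- The Coxeter matrix obtained from `M` by adjoining a generator `none` which satisfies no braid
relation with the others. -/
def CoxeterMatrix.adjoinFree {B : Type*} (M : CoxeterMatrix B) : CoxeterMatrix (Option B) where
  M := fun
    | none, none => 1
    | some i, some j => M i j
    | _, _ => 0
  isSymm := by
    ext (_ | i) (_ | j)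
    · rfl
    · rfl
    · rfl
    · exact M.symmetric j i
  diagonal := by
    rintro (_ | i)
    · rfl
    · exact M.diagonal i
  off_diagonal := by
    rintro (_ | i) (_ | j) h
    · exact absurd rfl h
    · exact zero_ne_one
    · exact zero_ne_one
    · exact M.off_diagonal i j fun hij => h (congrArg some hij)

namespace CoxeterSystem

variable {B W : Type*} [Group W] {M : CoxeterMatrix B} (cs : CoxeterSystem M W)

/-- The Coxeter system with the free generator adjoined. -/
def adjoinFree (_ : CoxeterSystem M W) : CoxeterSystem M.adjoinFree M.adjoinFree.Group :=
  M.adjoinFree.toCoxeterSystem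

/-- The inclusion of `W` as the standard parabolic subgroup generated by the old generators. -/
def inclFree : W →* M.adjoinFree.Group :=
  cs.lift ⟨fun i => cs.adjoinFree.simple (some i),
    fun i j => cs.adjoinFree.simple_mul_simple_pow (some i) (some j)⟩

theorem inclFree_simple (i : B) : cs.inclFree (cs.simple i) = cs.adjoinFree.simple (some i) :=
  cs.lift_apply_simple _ i

/-- The element `w⁻¹ z u`, where `z` is the free generator. -/
def crossFree (w u : W) : M.adjoinFree.Group :=
  cs.inclFree w⁻¹ * cs.adjoinFree.simple none * cs.inclFree u

theorem wordProd_map_some (ω : List B) :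
    cs.adjoinFree.wordProd (ω.map some) = cs.inclFree (cs.wordProd ω) := by
  induction ω with
  | nil => simp
  | cons i ω ih => rw [List.map_cons, wordProd_cons, ih, wordProd_cons, map_mul, inclFree_simple]

theorem wordProd_cross (X U : List B) :
    cs.adjoinFree.wordProd (X.map some ++ none :: U.map some) =
      cs.crossFree (cs.wordProd X)⁻¹ (cs.wordProd U) := by
  rw [wordProd_append, wordProd_cons, wordProd_map_some, wordProd_map_some, crossFree, inv_inv,
    mul_assoc]

/-! Normal forms are distinguished by the lamplighter action: on pairs of a set `A` of lit lamps and
a position `g` in `W`, an old generator moves the position and the free one toggles the lamp at the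
position. -/

open scoped symmDiff in
/-- The action of a generator on lamplighter configurations. -/
noncomputable def lampStep : Option B → Function.End (Set W × W)
  | none => fun p => (p.1 ∆ {p.2}, p.2)
  | some i => fun p => (p.1, cs.simple i * p.2)

theorem isLiftable_lampStep : M.adjoinFree.IsLiftable cs.lampStep := by
  rintro (_ | i) (_ | j)
  · change (cs.lampStep none * cs.lampStep none) ^ 1 = 1
    rw [pow_one]
    funext p
    exact Prod.ext (symmDiff_symmDiff_cancel_right _ _) rfl
  · exact pow_zero _
  · exact pow_zero _
  · change (cs.lampStep (some i) * cs.lampStep (some j)) ^ M i j = 1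
    have h : ∀ k p, ((cs.lampStep (some i) * cs.lampStep (some j)) ^ k) p =
        (p.1, (cs.simple i * cs.simple j) ^ k * p.2) := by
      intro k p
      induction k with
      | zero => rw [pow_zero, pow_zero, one_mul]; rfl
      | succ k ih =>
        rw [pow_succ', Function.End.mul_apply, ih, pow_succ', mul_assoc, mul_assoc]
        rfl
    funext p
    refine (h _ p).trans ?_
    rw [simple_mul_simple_pow, one_mul]
    rfl

/-- The lamplighter action. -/
noncomputable def lampAction : M.adjoinFree.Group →* Function.End (Set W × W) :=
  cs.adjoinFree.lift ⟨cs.lampStep, cs.isLiftable_lampStep⟩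

theorem lampAction_inclFree (w : W) (p : Set W × W) :
    cs.lampAction (cs.inclFree w) p = (p.1, w * p.2) := by
  induction w using cs.simple_induction_left generalizing p with
  | one => simp [Function.End.one_apply]
  | mul_simple_left w i ih =>
    rw [map_mul, map_mul, Function.End.mul_apply, ih, inclFree_simple, lampAction,
      lift_apply_simple, lampStep, mul_assoc]

theorem lampAction_crossFree (w u : W) :
    cs.lampAction (cs.crossFree w u) (∅, 1) = ({u}, w⁻¹ * u) := by
  rw [crossFree, map_mul, map_mul, Function.End.mul_apply, Function.End.mul_apply,
    lampAction_inclFree]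
  have h : cs.lampAction (cs.adjoinFree.simple none) = cs.lampStep none :=
    cs.adjoinFree.lift_apply_simple _ none
  rw [h, lampAction_inclFree]
  simp [lampStep]

theorem inclFree_injective : Function.Injective cs.inclFree := by
  intro x y h
  have := lampAction_inclFree cs x (∅, 1)
  rw [h, lampAction_inclFree] at this
  simpa using (congrArg Prod.snd this).symm

theorem crossFree_inj {w u w' u' : W} (h : cs.crossFree w u = cs.crossFree w' u') :
    w = w' ∧ u = u' := by
  have := lampAction_crossFree cs w u
  rw [h, lampAction_crossFree, Prod.mk.injEq, Set.singleton_eq_singleton_iff] at this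
  obtain ⟨rfl, h2⟩ := this
  exact ⟨(inv_injective (mul_right_cancel h2)).symm, rfl⟩

theorem crossFree_ne_inclFree (w u x : W) : cs.crossFree w u ≠ cs.inclFree x := by
  intro h
  have := lampAction_crossFree cs w u
  rw [h, lampAction_inclFree] at this
  exact Set.singleton_ne_empty u (congrArg Prod.fst this).symm

/-- The deletion property. -/
theorem exists_isReduced_sublist (ω : List B) :
    ∃ τ, τ.Sublist ω ∧ cs.IsReduced τ ∧ cs.wordProd τ = cs.wordProd ω := by
  induction ω using List.reverseRecOn with
  | nil => exact ⟨[], .refl _, by simp [IsReduced], rfl⟩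
  | append_singleton ω i ih =>
    obtain ⟨τ, h1, h2, h3⟩ := ih
    rw [wordProd_append, wordProd_singleton, ← h3]
    rcases cs.length_mul_simple (cs.wordProd τ) i with h | h
    · refine ⟨τ ++ [i], h1.append_right _, ?_, by rw [wordProd_append, wordProd_singleton]⟩
      rw [IsReduced, wordProd_append, wordProd_singleton, h, h2.eq, List.length_append,
        List.length_singleton]
    · obtain ⟨k, hk, he⟩ := cs.exists_eraseIdx_of_length_mul_lt (ω := τ) (t := cs.simple i)
        (cs.isReflection_simple i) (by omega)
      refine ⟨τ.eraseIdx k, ((List.eraseIdx_sublist ..).trans h1).trans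
        (List.sublist_append_left ..), ?_, he.symm⟩
      have := List.length_eraseIdx_add_one hk
      have := h2.eq
      rw [IsReduced, ← he]
      omega

theorem isReduced_map_some {ω : List B} (hω : cs.IsReduced ω) :
    cs.adjoinFree.IsReduced (ω.map some) := by
  obtain ⟨τ, h1, h2, h3⟩ := cs.adjoinFree.exists_isReduced_sublist (ω.map some)
  obtain ⟨σ, hσ, rfl⟩ := List.sublist_map_iff.1 h1
  rw [wordProd_map_some, wordProd_map_some] at h3
  have h4 := cs.inclFree_injective h3
  have h5 : ω.length ≤ σ.length := by
    rw [← hω.eq, ← h4]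
    exact cs.length_wordProd_le σ
  rwa [← hσ.eq_of_length_le h5]

/-- A subword of `X z U` has the form `X' z U'` or `X' U'`. -/
theorem sublist_cross {X U : List B} {τ : List (Option B)}
    (h : τ.Sublist (X.map some ++ none :: U.map some)) :
    ∃ X' U' : List B, X'.Sublist X ∧ U'.Sublist U ∧
      (τ = X'.map some ++ none :: U'.map some ∨ τ = (X' ++ U').map some) := by
  obtain ⟨l₁, l₂, rfl, h1, h2⟩ := List.sublist_append_iff.1 h
  obtain ⟨X', hX, rfl⟩ := List.sublist_map_iff.1 h1
  obtain h3 | ⟨r, rfl, h3⟩ := List.sublist_cons_iff.1 h2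
  · obtain ⟨U', hU, rfl⟩ := List.sublist_map_iff.1 h3
    exact ⟨X', U', hX, hU, Or.inr (List.map_append ..).symm⟩
  · obtain ⟨U', hU, rfl⟩ := List.sublist_map_iff.1 h3
    exact ⟨X', U', hX, hU, Or.inl rfl⟩

theorem isReduced_cross {X U : List B} (hX : cs.IsReduced X) (hU : cs.IsReduced U) :
    cs.adjoinFree.IsReduced (X.map some ++ none :: U.map some) := by
  obtain ⟨τ, h1, h2, h3⟩ :=
    cs.adjoinFree.exists_isReduced_sublist (X.map some ++ none :: U.map some)
  obtain ⟨X', U', hX', hU', rfl | rfl⟩ := sublist_cross h1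
  · rw [wordProd_cross, wordProd_cross] at h3
    obtain ⟨h4, h5⟩ := cs.crossFree_inj h3
    have h6 : X.length ≤ X'.length := by
      rw [← hX.eq, ← inv_injective h4]
      exact cs.length_wordProd_le X'
    have h7 : U.length ≤ U'.length := by
      rw [← hU.eq, ← h5]
      exact cs.length_wordProd_le U'
    rwa [← hX'.eq_of_length_le h6, ← hU'.eq_of_length_le h7]
  · rw [wordProd_cross, wordProd_map_some] at h3
    exact absurd h3.symm (cs.crossFree_ne_inclFree _ _ _)

theorem bruhatLE_inclFree_iff {a : M.adjoinFree.Group} {y : W} :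
    cs.adjoinFree.BruhatLE a (cs.inclFree y) ↔ ∃ x, cs.BruhatLE x y ∧ a = cs.inclFree x := by
  obtain ⟨ω, hω, rfl⟩ := cs.exists_isReduced y
  constructor
  · intro h
    rw [← wordProd_map_some] at h
    obtain ⟨τ, hτ, rfl⟩ := exists_sublist_of_bruhatLE _ h
    obtain ⟨σ, hσ, rfl⟩ := List.sublist_map_iff.1 hτ
    exact ⟨_, bruhatLE_of_sublist cs hσ hω, wordProd_map_some cs σ⟩
  · rintro ⟨x, hx, rfl⟩
    obtain ⟨τ, hτ, rfl⟩ := exists_sublist_of_bruhatLE _ hx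
    rw [← wordProd_map_some, ← wordProd_map_some]
    exact bruhatLE_of_sublist _ (hτ.map some) (cs.isReduced_map_some hω)

/-- The elements below `w⁻¹ z u`, by the subword property. -/
theorem bruhatLE_crossFree_iff {a : M.adjoinFree.Group} {w u : W} :
    cs.adjoinFree.BruhatLE a (cs.crossFree w u) ↔
      ∃ w' u', cs.BruhatLE w' w ∧ cs.BruhatLE u' u ∧
        (a = cs.crossFree w' u' ∨ a = cs.inclFree (w'⁻¹ * u')) := by
  obtain ⟨X, hX, hw⟩ := cs.exists_isReduced w⁻¹
  obtain ⟨U, hU, rfl⟩ := cs.exists_isReduced u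
  obtain rfl : w = (cs.wordProd X)⁻¹ := inv_eq_iff_eq_inv.1 hw
  rw [← wordProd_cross]
  have hred := cs.isReduced_cross hX hU
  constructor
  · intro h
    obtain ⟨τ, hτ, rfl⟩ := exists_sublist_of_bruhatLE _ h
    obtain ⟨X', U', hX', hU', rfl | rfl⟩ := sublist_cross hτ
    · exact ⟨_, _, (bruhatLE_of_sublist cs hX' hX).inv, bruhatLE_of_sublist cs hU' hU,
        Or.inl (wordProd_cross cs X' U')⟩
    · refine ⟨_, _, (bruhatLE_of_sublist cs hX' hX).inv, bruhatLE_of_sublist cs hU' hU, Or.inr ?_⟩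
      rw [wordProd_map_some, wordProd_append, inv_inv]
  · rintro ⟨w', u', hw', hu', h⟩
    rw [← bruhatLE_inv_iff, inv_inv] at hw'
    obtain ⟨X', hX', hw'⟩ := exists_sublist_of_bruhatLE _ hw'
    obtain ⟨U', hU', rfl⟩ := exists_sublist_of_bruhatLE _ hu'
    obtain rfl : w' = (cs.wordProd X')⁻¹ := inv_eq_iff_eq_inv.1 hw'
    rcases h with rfl | rfl
    · rw [← wordProd_cross]
      exact bruhatLE_of_sublist _ ((hX'.map some).append ((hU'.map some).cons_cons none)) hred
    · rw [inv_inv, ← wordProd_append, ← wordProd_map_some, List.map_append]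
      exact bruhatLE_of_sublist _ ((hX'.map some).append ((hU'.map some).cons none)) hred

theorem inclFree_le_inclFree_iff {x y : W} :
    cs.adjoinFree.BruhatLE (cs.inclFree x) (cs.inclFree y) ↔ cs.BruhatLE x y := by
  rw [bruhatLE_inclFree_iff]
  constructor
  · rintro ⟨x', h, he⟩
    rwa [cs.inclFree_injective he]
  · exact fun h => ⟨x, h, rfl⟩

theorem crossFree_le_crossFree_iff {w u w' u' : W} :
    cs.adjoinFree.BruhatLE (cs.crossFree w' u') (cs.crossFree w u) ↔
      cs.BruhatLE w' w ∧ cs.BruhatLE u' u := by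
  rw [bruhatLE_crossFree_iff]
  constructor
  · rintro ⟨w₁, u₁, hw, hu, h | h⟩
    · obtain ⟨rfl, rfl⟩ := cs.crossFree_inj h
      exact ⟨hw, hu⟩
    · exact absurd h (cs.crossFree_ne_inclFree _ _ _)
  · rintro ⟨hw, hu⟩
    exact ⟨w', u', hw, hu, Or.inl rfl⟩

/-- The condition `w ∘ₗ v ≤ u` is a Bruhat relation in the larger Coxeter group. -/
theorem inclFree_le_crossFree_iff {w v u : W} :
    cs.adjoinFree.BruhatLE (cs.inclFree v) (cs.crossFree w u) ↔
      ∃ m, cs.IsLeftDownwardDemazure w v m ∧ cs.BruhatLE m u := by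
  rw [exists_isLeftDownwardDemazure_le_iff, bruhatLE_crossFree_iff]
  constructor
  · rintro ⟨w', u', hw, hu, h | h⟩
    · exact absurd h.symm (cs.crossFree_ne_inclFree _ _ _)
    · exact ⟨w', u', hw, hu, cs.inclFree_injective h⟩
  · rintro ⟨w', u', hw, hu, rfl⟩
    exact ⟨w', u', hw, hu, Or.inr rfl⟩

end CoxeterSystem

/-! ### Bruhat intervals -/

/-- Chain shellings can be pulled back along an injection under which the chains correspond. -/
theorem IsChainShelling.comap {R R' α : Type*} [LT α] [LE α] {r : R → R → Prop}
    {r' : R' → R' → Prop} {n : ℕ} {a b : R} {a' b' : R'} {key : (ℕ → R') → α}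
    (h : IsChainShelling r' n a' b' key) {f : R → R'} (hf : Function.Injective f)
    (h1 : ∀ c, IsDescChain r n a b c → IsDescChain r' n a' b' (f ∘ c))
    (h2 : ∀ c', IsDescChain r' n a' b' c' → ∃ c, IsDescChain r n a b c ∧ f ∘ c = c') :
    IsChainShelling r n a b fun c => key (f ∘ c) := by
  intro c c' hc hc' hkey hagree
  refine hf.comp_left (h _ _ (h1 c hc) (h1 c' hc') hkey fun i z hi hin hz hlt => ?_)
  obtain ⟨d, hd, he⟩ := h2 _ hz
  have hd' : d = Function.update c i (d i) := by
    funext j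
    have hj := congrFun he j
    by_cases hji : j = i
    · subst hji
      rw [Function.update_self]
    · rw [Function.update_of_ne hji] at hj ⊢
      exact hf hj
  rw [← he, hd'] at hlt
  rw [hd'] at hd
  exact congrArg f (hagree i (d i) hi hin hd hlt)

namespace CoxeterSystem

/-- The group `W` with its Bruhat order. -/
def BruhatOrder {B W : Type*} [Group W] {M : CoxeterMatrix B} (_ : CoxeterSystem M W) : Type _ := W

variable {B W : Type*} [Group W] {M : CoxeterMatrix B} (cs : CoxeterSystem M W)

instance : PartialOrder cs.BruhatOrder where
  le := cs.BruhatLE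
  le_refl _ := .refl
  le_trans _ _ _ h h' := h.trans h'
  le_antisymm _ _ h h' := BruhatLE.antisymm cs h h'

variable {cs} {x y : cs.BruhatOrder}

/-- The length function on a Bruhat interval. -/
noncomputable def intervalLength (p : Set.Icc x y) : ℕ := cs.length (p.1 : W)

instance : Finite (Set.Icc x y) :=
  ((finite_setOf_bruhatLE cs y).subset fun _ h => h.2).to_subtype

theorem intervalLength_strictMono : StrictMono (intervalLength : Set.Icc x y → ℕ) := by
  intro p q hpq
  exact (BruhatLE.eq_or_length_lt cs (x := p.1) (y := q.1) hpq.le).resolve_left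
    fun h => hpq.ne (Subtype.ext h)

theorem bruhatCov_iff_covBy {p q : Set.Icc x y} : cs.BruhatCov p.1 q.1 ↔ p ⋖ q := by
  constructor
  · rintro ⟨hle, hlen⟩
    have hle' : p ≤ q := hle
    refine ⟨hle'.lt_of_ne ?_, fun r hpr hrq => ?_⟩
    · rintro rfl
      omega
    · have h1 := intervalLength_strictMono hpr
      have h2 := intervalLength_strictMono hrq
      rw [intervalLength, intervalLength] at h1 h2
      omega
  · intro h
    have hne : p.1 ≠ q.1 := fun he => h.ne (Subtype.ext he)
    obtain ⟨z, hpz, hzq, hlen⟩ := exists_bruhat_coatom cs (x := p.1) (y := q.1) h.le hne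
    let z' : Set.Icc x y := ⟨z, le_trans p.2.1 hpz, le_trans (b := q.1) hzq q.2.2⟩
    have hpz' : p ≤ z' := hpz
    have hzq' : z' ≤ q := hzq
    rcases hpz'.eq_or_lt with hp | hlt
    · have : z = p.1 := congrArg Subtype.val hp.symm
      exact ⟨h.le, this ▸ hlen⟩
    · rcases hzq'.eq_or_lt with he | hlt'
      · have : z = q.1 := congrArg Subtype.val he
        rw [this] at hlen
        omega
      · exact absurd hlt' (h.2 hlt)

theorem intervalLength_covBy {p q : Set.Icc x y} (h : p ⋖ q) :
    intervalLength q = intervalLength p + 1 :=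
  (bruhatCov_iff_covBy.2 h).2.symm

/-- Bruhat intervals have chain shellings. -/
theorem exists_isChainShelling_interval [Fact (x ≤ y)] (n : ℕ) :
    ∃ key : (ℕ → Set.Icc x y) → Lex (ℕ → ℕᵒᵈ),
      IsChainShelling (· ⋖ ·) n (⊤ : Set.Icc x y) ⊥ key := by
  obtain ⟨ω, hω, hy⟩ := cs.exists_isReduced (show W from y)
  have h : IsChainShelling cs.BruhatCov n (show W from y) x (chainKey cs ω n) :=
    hy ▸ isChainShelling_chainKey hω
  refine ⟨_, h.comap (f := Subtype.val) Subtype.val_injective (fun c hc => ?_) fun c hc => ?_⟩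
  · exact ⟨congrArg Subtype.val hc.zero, fun i hi => bruhatCov_iff_covBy.2 (hc.rel i hi),
      fun i hi => congrArg Subtype.val (hc.last i hi)⟩
  · have hanti : Antitone (β := cs.BruhatOrder) c := by
      refine antitone_nat_of_succ_le fun i => ?_
      rcases lt_or_ge i n with hi | hi
      · exact (hc.rel i hi).1
      · rw [hc.last i hi, hc.last (i + 1) (by omega)]
    have hlast : ∀ i, n ≤ i → x ≤ c i := fun i hi =>
      le_of_eq (α := cs.BruhatOrder) (hc.last i hi).symm
    have hmem : ∀ i, c i ∈ Set.Icc x y := by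
      intro i
      refine ⟨?_, (hanti (Nat.zero_le i)).trans_eq hc.zero⟩
      rcases le_or_gt n i with hi | hi
      · exact hlast i hi
      · exact (hlast n le_rfl).trans (hanti hi.le)
    exact ⟨fun i => ⟨c i, hmem i⟩,
      ⟨Subtype.ext hc.zero, fun i hi => bruhatCov_iff_covBy.1 (hc.rel i hi),
        fun i hi => Subtype.ext (hc.last i hi)⟩, rfl⟩

end CoxeterSystem

/-! ### Strata as crossing pairs -/

namespace CoxeterSystem

variable {B W : Type*} [Group W] {M : CoxeterMatrix B} {cs : CoxeterSystem M W}

/-- The upper set of those elements of a Bruhat interval of the enlarged group which involve the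
free generator. -/
def freeUpper (x y : cs.adjoinFree.BruhatOrder) : Set (Set.Icc x y) :=
  {p | p.1 ∉ Set.range cs.inclFree}

theorem isUpperSet_freeUpper {x y : cs.adjoinFree.BruhatOrder} : IsUpperSet (freeUpper x y) := by
  rintro p q hpq hp ⟨w, hw⟩
  have h : cs.adjoinFree.BruhatLE p.1 q.1 := hpq
  rw [← hw] at h
  obtain ⟨v, -, hv⟩ := cs.bruhatLE_inclFree_iff.1 h
  exact hp ⟨v, hv.symm⟩

namespace StratumIndex

/-- The lower end `v` of the Bruhat interval attached to `(w, v, u)`. -/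
def lo (q : StratumIndex cs) : cs.adjoinFree.BruhatOrder := cs.inclFree q.v

/-- The upper end `w⁻¹ z u` of the Bruhat interval attached to `(w, v, u)`. -/
def hi (q : StratumIndex cs) : cs.adjoinFree.BruhatOrder := cs.crossFree q.w q.u

theorem lo_le_hi (q : StratumIndex cs) : q.lo ≤ q.hi :=
  cs.inclFree_le_crossFree_iff.2 q.demazure_le

theorem le_iff {p q : StratumIndex cs} : p ≤ q ↔ q.lo ≤ p.lo ∧ p.hi ≤ q.hi := by
  have h1 : q.lo ≤ p.lo ↔ cs.BruhatLE q.v p.v := cs.inclFree_le_inclFree_iff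
  have h2 : p.hi ≤ q.hi ↔ cs.BruhatLE p.w q.w ∧ cs.BruhatLE p.u q.u :=
    cs.crossFree_le_crossFree_iff
  rw [h1, h2]
  exact and_left_comm

instance (q : StratumIndex cs) : Fact (q.lo ≤ q.hi) := ⟨q.lo_le_hi⟩

/-- The crossing pair `(v, w⁻¹ z u)` of an element `(w, v, u)` below `q`. -/
def toCrossing (q : StratumIndex cs) (p : Set.Iic q) : Crossing (freeUpper q.lo q.hi) where
  lo := ⟨p.1.lo, (le_iff.1 p.2).1, p.1.lo_le_hi.trans (le_iff.1 p.2).2⟩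
  hi := ⟨p.1.hi, (le_iff.1 p.2).1.trans p.1.lo_le_hi, (le_iff.1 p.2).2⟩
  lo_notMem h := h ⟨p.1.v, rfl⟩
  hi_mem := fun ⟨_, hx⟩ => cs.crossFree_ne_inclFree _ _ _ hx.symm
  lo_le_hi := p.1.lo_le_hi

theorem toCrossing_surjective (q : StratumIndex cs) : Function.Surjective q.toCrossing := by
  intro c
  obtain ⟨v, hv⟩ := not_not.1 c.lo_notMem
  have hqv : cs.BruhatLE q.v v := by
    rw [← cs.inclFree_le_inclFree_iff, hv]
    exact c.lo.2.1
  obtain ⟨w, u, hw, hu, h | h⟩ := cs.bruhatLE_crossFree_iff.1 c.hi.2.2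
  · have hle : cs.adjoinFree.BruhatLE c.lo.1 c.hi.1 := c.lo_le_hi
    rw [← hv, h, inclFree_le_crossFree_iff] at hle
    exact ⟨⟨⟨w, v, u, hle⟩, hw, hqv, hu⟩, Crossing.ext (Subtype.ext hv) (Subtype.ext h.symm)⟩
  · exact absurd ⟨_, h.symm⟩ c.hi_mem

/-- The elements below `q` are the crossing pairs of a Bruhat interval of the enlarged group. -/
noncomputable def crossingIso (q : StratumIndex cs) :
    Set.Iic q ≃o Crossing (freeUpper q.lo q.hi) :=
  RelIso.ofSurjective (OrderEmbedding.ofMapLEIff q.toCrossing fun _ _ => le_iff.symm)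
    q.toCrossing_surjective

end StratumIndex

end CoxeterSystem

/-- The principal ideal of `q` after adjoining a minimum. -/
def WithBot.iccBotCoeIso {α : Type*} [PartialOrder α] (q : α) :
    Set.Icc (⊥ : WithBot α) q ≃o WithBot (Set.Iic q) where
  toFun x := match x with
    | ⟨⊥, _⟩ => ⊥
    | ⟨(a : α), h⟩ => ((⟨a, WithBot.coe_le_coe.1 h.2⟩ : Set.Iic q) : WithBot (Set.Iic q))
  invFun y := match y with
    | ⊥ => ⟨⊥, le_rfl, bot_le⟩
    | (a : Set.Iic q) => ⟨(a.1 : WithBot α), bot_le, WithBot.coe_le_coe.2 a.2⟩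
  left_inv := by
    rintro ⟨_ | a, h⟩ <;> rfl
  right_inv := by
    rintro (_ | a) <;> rfl
  map_rel_iff' := by
    rintro ⟨_ | a, ha⟩ ⟨_ | b, hb⟩
    · exact iff_of_true le_rfl le_rfl
    · exact iff_of_true bot_le (bot_le (a := (b : WithBot α)))
    · exact iff_of_false (WithBot.not_coe_le_bot _) (WithBot.not_coe_le_bot _)
    · exact WithBot.coe_le_coe.trans (WithBot.coe_le_coe (a := a) (b := b)).symm

theorem mainTheorem12 {B W : Type*} [Finite B] [Group W] {M : CoxeterMatrix B}
    (cs : CoxeterSystem M W) (q : WithBot (CoxeterSystem.StratumIndex cs)) :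
    IsShellablePoset (Set.Icc ⊥ q) := by
  induction q with
  | bot =>
    have : Subsingleton (Set.Icc (⊥ : WithBot cs.StratumIndex) ⊥) :=
      (Set.Icc_self (⊥ : WithBot cs.StratumIndex)) ▸ inferInstance
    exact isShellablePoset_of_isChainShelling (ρ := fun _ => 0) (n := 0) (key := fun _ => 0)
      (a := ⟨⊥, le_rfl, le_rfl⟩) (b := ⟨⊥, le_rfl, le_rfl⟩)
      (fun x y h => absurd (Subsingleton.elim x y) h.ne)
      (fun x y h => absurd (Subsingleton.elim x y) h.ne) (fun x => (Subsingleton.elim x _).le)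
      (fun x => (Subsingleton.elim _ x).le) rfl rfl
      fun c c' _ _ _ _ => funext fun i => Subsingleton.elim _ _
  | coe q =>
    let e := (WithBot.iccBotCoeIso q).trans q.crossingIso.withBotCongr
    have : Finite (Set.Icc (⊥ : WithBot cs.StratumIndex) q) := Finite.of_equiv _ e.symm.toEquiv
    let t : Crossing (CoxeterSystem.freeUpper q.lo q.hi) := q.toCrossing ⟨q, Set.mem_Iic.2 le_rfl⟩
    have het : e ⟨q, bot_le, le_rfl⟩ = t := rfl
    have heb : e ⟨⊥, le_rfl, bot_le⟩ = ⊥ := rfl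
    set ℓ : Set.Icc q.lo q.hi → ℕ := CoxeterSystem.intervalLength
    have hℓ : StrictMono ℓ := CoxeterSystem.intervalLength_strictMono
    have hcov : ∀ x y, x ⋖ y → ℓ y = ℓ x + 1 :=
      fun x y h => CoxeterSystem.intervalLength_covBy h
    have hbt : ℓ ⊥ ≤ ℓ ⊤ := hℓ.monotone bot_le
    have hY := CoxeterSystem.isUpperSet_freeUpper (x := q.lo) (y := q.hi)
    obtain ⟨key, hkey⟩ :=
      CoxeterSystem.exists_isChainShelling_interval (x := q.lo) (y := q.hi) (ℓ ⊤ - ℓ ⊥)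
    have hshell := isChainShelling_crossingKey hY hℓ hcov (t := t) (by omega) ⟨rfl, rfl⟩ hkey
    have hpull := hshell.comap (r := (· ⋖ ·)) (a := ⟨q, bot_le, le_rfl⟩) (b := ⟨⊥, le_rfl, bot_le⟩)
      e.injective
      (fun c hc => ⟨(congrArg e hc.zero).trans het,
        fun i hi => (apply_covBy_apply_iff e).2 (hc.rel i hi),
        fun i hi => (congrArg e (hc.last i hi)).trans heb⟩)
      fun c hc => ⟨e.symm ∘ c, ⟨e.symm_apply_eq.2 (hc.zero.trans het.symm),
        fun i hi => (apply_covBy_apply_iff e.symm).2 (hc.rel i hi),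
        fun i hi => e.symm_apply_eq.2 ((hc.last i hi).trans heb.symm)⟩,
        funext fun i => e.apply_symm_apply _⟩
    refine isShellablePoset_of_isChainShelling (ρ := fun x => Crossing.rank ℓ (e x))
      ((Crossing.rank_strictMono hℓ).comp e.strictMono)
      (fun x y h => Crossing.rank_covBy hY hℓ hcov ((apply_covBy_apply_iff e).2 h)) (fun x => x.2.2)
      (fun x => x.2.1) ?_ ?_ hpull
    · rw [het]
      rfl
    · rw [heb]
      rfl
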